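/- Let $X^\bullet\colon\Delta\to\mathrm{Top}$ be a cosimplicial space and let $\mathbb K$ be a field of characteristic $0$. Let $A_{PL}(-;\mathbb K)\colon \mathrm{Top}^{op}\to\mathrm{CDGA}_{\mathbb K}$ be Sullivan's functor of piecewise polynomial differential forms (polynomial forms on the singular simplicial set). Suppose that $X^\bullet$ is $\mathbb K$-formal, i.e. that the diagram $A_{PL}(X^\bullet;\mathbb K)\colon\Delta^{op}\to\mathrm{CDGA}_{\mathbb K}$ is connected by a finite zig-zag of natural quasi-isomorphisms of diagrams of CDGAs to its cohomology $H(A_{PL}(X^\bullet;\mathbb K))$ (with zero differential). Then for every field $L$ of characteristic $0$ the homology Bousfield–Kan spectral sequence of $X^\bullet$ with coefficients in $L$ collapses at the $E^2$ page: all differentials $d^r$ with $r\ge 2$ vanish. Here the homology Bousfield–Kan spectral sequence is the spectral sequence of the total complex $T_n=\prod_{m\ge0}N^mN_{m+n}(X^\bullet;L)$, filtered by cosimplicial degree $m$, where $N_*(X^m;L)$ is the normalized singular chain complex of $X^m$ and $N^m$ denotes conormalization (the intersection of the kernels of the codegeneracies) in the cosimplicial direction. -/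

import Mathlib

open CategoryTheory

open scoped TensorProduct

universe u v w

/-- A commutative differential graded algebra over a field `K` of characteristic zero, cohomologically
graded by `ℕ`. The product `A p × A q → A (p + q)` is indexed by a proof of `p + q = n` to avoid casts. -/
structure CDGA (K : Type v) [Field K] where
  A : ℕ → Type w
  [addCommGroup : ∀ p, AddCommGroup (A p)]
  [module : ∀ p, Module K (A p)]
  d (p : ℕ) : A p →ₗ[K] A (p + 1)
  mul {p q n : ℕ} (h : p + q = n) : A p →ₗ[K] A q →ₗ[K] A n
  one : A 0
  one_mul {p : ℕ} (a : A p) : mul (zero_add p) one a = a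
  mul_one {p : ℕ} (a : A p) : mul (add_zero p) a one = a
  mul_assoc {p q r s t n : ℕ} (hs : p + q = s) (ht : q + r = t) (h : s + r = n) (h' : p + t = n)
    (a : A p) (b : A q) (c : A r) : mul h (mul hs a b) c = mul h' a (mul ht b c)
  mul_comm {p q n : ℕ} (h : p + q = n) (h' : q + p = n) (a : A p) (b : A q) :
    mul h a b = (-1 : K) ^ (p * q) • mul h' b a
  d_d {p : ℕ} (a : A p) : d (p + 1) (d p a) = 0
  leibniz {p q n : ℕ} (h : p + q = n) (h₁ : (p + 1) + q = n + 1) (h₂ : p + (q + 1) = n + 1)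
    (a : A p) (b : A q) :
    d n (mul h a b) = mul h₁ (d p a) b + (-1 : K) ^ p • mul h₂ a (d q b)

namespace CDGA

attribute [instance] CDGA.addCommGroup CDGA.module

variable {K : Type v} [Field K]

/-- Morphisms: degreewise linear maps compatible with differentials, products and units. -/
@[ext]
structure Hom (A B : CDGA.{v, w} K) where
  f (p : ℕ) : A.A p →ₗ[K] B.A p
  map_d {p : ℕ} (a : A.A p) : f (p + 1) (A.d p a) = B.d p (f p a)
  map_mul {p q n : ℕ} (h : p + q = n) (a : A.A p) (b : A.A q) :
    f n (A.mul h a b) = B.mul h (f p a) (f q b)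
  map_one : f 0 A.one = B.one

instance : Category (CDGA.{v, w} K) where
  Hom := Hom
  id A :=
    { f := fun _ => LinearMap.id
      map_d := fun _ => rfl
      map_mul := fun _ _ _ => rfl
      map_one := rfl }
  comp F G :=
    { f := fun p => (G.f p).comp (F.f p)
      map_d := fun a => by simp [F.map_d, G.map_d]
      map_mul := fun h a b => by simp [F.map_mul, G.map_mul]
      map_one := by simp [F.map_one, G.map_one] }

lemma hom_ext {A B : CDGA.{v, w} K} {F G : A ⟶ B} (h : ∀ p a, F.f p a = G.f p a) : F = G :=
  Hom.ext (funext fun p => LinearMap.ext (h p))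

@[simp] lemma id_f (A : CDGA.{v, w} K) (p : ℕ) : Hom.f (𝟙 A) p = LinearMap.id := rfl

@[simp] lemma comp_f {A B C : CDGA.{v, w} K} (F : A ⟶ B) (G : B ⟶ C) (p : ℕ) :
    Hom.f (F ≫ G) p = (Hom.f G p).comp (Hom.f F p) := rfl

variable (A : CDGA.{v, w} K)

/-- Cocycles of degree `p`. -/
def cocycles (p : ℕ) : Submodule K (A.A p) := LinearMap.ker (A.d p)

/-- Coboundaries of degree `n`; there are none in degree `0`. -/
def coboundaries : ∀ n : ℕ, Submodule K (A.A n)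
  | 0 => ⊥
  | n + 1 => LinearMap.range (A.d n)

/-- The coboundaries as a subspace of the cocycles. -/
def coboundariesIn (n : ℕ) : Submodule K (A.cocycles n) :=
  (A.coboundaries n).comap (A.cocycles n).subtype

lemma mul_mem_cocycles {p q n : ℕ} (h : p + q = n) {a : A.A p} {b : A.A q}
    (ha : a ∈ A.cocycles p) (hb : b ∈ A.cocycles q) : A.mul h a b ∈ A.cocycles n := by
  have ha' : A.d p a = 0 := ha
  have hb' : A.d q b = 0 := hb
  change A.d n (A.mul h a b) = 0
  rw [A.leibniz h (by omega) (by omega), ha', hb']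
  simp

lemma mul_mem_coboundaries_left {p q n : ℕ} (h : p + q = n) {a : A.A p} {b : A.A q}
    (ha : a ∈ A.coboundaries p) (hb : b ∈ A.cocycles q) : A.mul h a b ∈ A.coboundaries n := by
  have hb' : A.d q b = 0 := hb
  cases p with
  | zero =>
    obtain rfl : a = 0 := by simpa [coboundaries] using ha
    simp
  | succ p =>
    obtain ⟨y, rfl⟩ := ha
    obtain ⟨m, rfl⟩ : ∃ m, n = m + 1 := ⟨n - 1, by omega⟩
    refine ⟨A.mul (by omega : p + q = m) y b, ?_⟩
    rw [A.leibniz _ h (by omega), hb']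
    simp

lemma mul_mem_coboundaries_right {p q n : ℕ} (h : p + q = n) {a : A.A p} {b : A.A q}
    (ha : a ∈ A.cocycles p) (hb : b ∈ A.coboundaries q) : A.mul h a b ∈ A.coboundaries n := by
  rw [A.mul_comm h (by omega)]
  exact Submodule.smul_mem _ _ (A.mul_mem_coboundaries_left _ hb ha)

/-- The cohomology `H^n(A)`. -/
abbrev H (n : ℕ) : Type w := A.cocycles n ⧸ A.coboundariesIn n

/-- The product of cocycles. -/
def cocyclesMul {p q n : ℕ} (h : p + q = n) :
    A.cocycles p →ₗ[K] A.cocycles q →ₗ[K] A.cocycles n :=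
  LinearMap.mk₂ K (fun a b => ⟨A.mul h a b, A.mul_mem_cocycles h a.2 b.2⟩)
    (fun a a' b => Subtype.ext (by simp)) (fun c a b => Subtype.ext (by simp))
    (fun a b b' => Subtype.ext (by simp)) (fun c a b => Subtype.ext (by simp))

/-- The product on cohomology, `[a] [b] = [a b]`. -/
def mulH {p q n : ℕ} (h : p + q = n) : A.H p →ₗ[K] A.H q →ₗ[K] A.H n :=
  Submodule.liftQ _
    (LinearMap.mk₂ K
      (fun a => Submodule.mapQ _ _ (A.cocyclesMul h a)
        (fun _ hb => A.mul_mem_coboundaries_right h a.2 hb))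
      (fun a a' b => by
        obtain ⟨b, rfl⟩ := Submodule.Quotient.mk_surjective _ b
        exact congrArg (Submodule.Quotient.mk (p := A.coboundariesIn n))
          (LinearMap.map_add₂ (A.cocyclesMul h) a a' b))
      (fun c a b => by
        obtain ⟨b, rfl⟩ := Submodule.Quotient.mk_surjective _ b
        exact congrArg (Submodule.Quotient.mk (p := A.coboundariesIn n))
          (LinearMap.map_smul₂ (A.cocyclesMul h) c a b))
      (fun a b b' => by simp)
      (fun c a b => by simp))
    (fun a ha => by
      refine LinearMap.ext fun b => ?_
      obtain ⟨b, rfl⟩ := Submodule.Quotient.mk_surjective _ b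
      exact (Submodule.Quotient.mk_eq_zero _).2 (A.mul_mem_coboundaries_left h ha b.2))

lemma mulH_mk {p q n : ℕ} (h : p + q = n) (a : A.cocycles p) (b : A.cocycles q) :
    A.mulH h (Submodule.Quotient.mk a) (Submodule.Quotient.mk b) =
      Submodule.Quotient.mk (A.cocyclesMul h a b) := rfl

lemma one_mem_cocycles : A.one ∈ A.cocycles 0 := by
  have h := A.leibniz (add_zero 0) (add_zero 1) (zero_add 1) A.one A.one
  have h1 : A.mul (add_zero 1) (A.d 0 A.one) A.one = A.d 0 A.one := A.mul_one _
  have h2 : A.mul (zero_add 1) A.one (A.d 0 A.one) = A.d 0 A.one := A.one_mul _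
  rw [A.mul_one] at h
  simp only [h1, h2, pow_zero, one_smul] at h
  exact left_eq_add.1 h

/-- The cohomology algebra `H(A)`, a CDGA with zero differential. -/
def cohomology : CDGA.{v, w} K where
  A := A.H
  d _ := 0
  mul h := A.mulH h
  one := Submodule.Quotient.mk ⟨A.one, A.one_mem_cocycles⟩
  one_mul a := by
    obtain ⟨a, rfl⟩ := Submodule.Quotient.mk_surjective _ a
    rw [mulH_mk]
    exact congrArg _ (Subtype.ext (A.one_mul a.1))
  mul_one a := by
    obtain ⟨a, rfl⟩ := Submodule.Quotient.mk_surjective _ a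
    rw [mulH_mk]
    exact congrArg _ (Subtype.ext (A.mul_one a.1))
  mul_assoc hs ht h h' a b c := by
    obtain ⟨a, rfl⟩ := Submodule.Quotient.mk_surjective _ a
    obtain ⟨b, rfl⟩ := Submodule.Quotient.mk_surjective _ b
    obtain ⟨c, rfl⟩ := Submodule.Quotient.mk_surjective _ c
    simp only [mulH_mk]
    exact congrArg _ (Subtype.ext (A.mul_assoc hs ht h h' a.1 b.1 c.1))
  mul_comm h h' a b := by
    obtain ⟨a, rfl⟩ := Submodule.Quotient.mk_surjective _ a
    obtain ⟨b, rfl⟩ := Submodule.Quotient.mk_surjective _ b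
    simp only [mulH_mk, ← Submodule.Quotient.mk_smul]
    exact congrArg _ (Subtype.ext (A.mul_comm h h' a.1 b.1))
  d_d _ := rfl
  leibniz _ _ _ _ _ := by simp

variable {A}

lemma Hom.mem_cocycles {B : CDGA.{v, w} K} (F : A ⟶ B) {p : ℕ} {a : A.A p}
    (ha : a ∈ A.cocycles p) : F.f p a ∈ B.cocycles p := by
  have ha' : A.d p a = 0 := ha
  change B.d p (F.f p a) = 0
  rw [← F.map_d, ha', map_zero]

lemma Hom.mem_coboundaries {B : CDGA.{v, w} K} (F : A ⟶ B) {p : ℕ} {a : A.A p}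
    (ha : a ∈ A.coboundaries p) : F.f p a ∈ B.coboundaries p := by
  cases p with
  | zero =>
    obtain rfl : a = 0 := by simpa [coboundaries] using ha
    simp
  | succ p =>
    obtain ⟨y, rfl⟩ := ha
    exact ⟨F.f p y, (F.map_d y).symm⟩

/-- The map induced on `H^p` by a morphism of CDGAs. -/
def mapH {B : CDGA.{v, w} K} (F : A ⟶ B) (p : ℕ) : A.H p →ₗ[K] B.H p :=
  Submodule.mapQ _ _ ((F.f p).restrict fun _ ha => F.mem_cocycles ha)
    (fun _ ha => F.mem_coboundaries ha)

lemma mapH_mk {B : CDGA.{v, w} K} (F : A ⟶ B) (p : ℕ) (a : A.cocycles p) :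
    mapH F p (Submodule.Quotient.mk a) =
      Submodule.Quotient.mk ⟨F.f p a, F.mem_cocycles a.2⟩ := rfl

/-- Cohomology as a functor from CDGAs to CDGAs with zero differential. -/
def cohomologyFunctor (K : Type v) [Field K] : CDGA.{v, w} K ⥤ CDGA.{v, w} K where
  obj A := A.cohomology
  map {A B} F :=
    { f := fun p => mapH F p
      map_d := fun {p} a => map_zero (mapH F (p + 1))
      map_mul := fun {p q n} h a b => by
        obtain ⟨a, rfl⟩ := Submodule.Quotient.mk_surjective _ a
        obtain ⟨b, rfl⟩ := Submodule.Quotient.mk_surjective _ b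
        exact congrArg Submodule.Quotient.mk (Subtype.ext (F.map_mul h a.1 b.1))
      map_one := congrArg Submodule.Quotient.mk (Subtype.ext F.map_one) }
  map_id A := hom_ext fun p a => by
    obtain ⟨a, rfl⟩ := Submodule.Quotient.mk_surjective _ a
    rfl
  map_comp F G := hom_ext fun p a => by
    obtain ⟨a, rfl⟩ := Submodule.Quotient.mk_surjective _ a
    rfl

/-- A morphism of CDGAs is a quasi-isomorphism if it is bijective on cohomology. -/
def IsQuasiIso {A B : CDGA.{v, w} K} (F : A ⟶ B) : Prop :=
  ∀ p, Function.Bijective (mapH F p)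

/-- There is a natural quasi-isomorphism from the diagram `A` to the diagram `B`. -/
def NatQuasiIso {J : Type*} [Category* J] (A B : J ⥤ CDGA.{v, w} K) : Prop :=
  ∃ η : A ⟶ B, ∀ j, IsQuasiIso (η.app j)

/-- A diagram of CDGAs is formal if it is connected to its cohomology by a (finite) zig-zag of natural
quasi-isomorphisms: the equivalence relation generated by `NatQuasiIso` relates the two. -/
def IsFormal {J : Type*} [Category* J] (A : J ⥤ CDGA.{v, w} K) : Prop :=
  Relation.EqvGen NatQuasiIso A (A ⋙ cohomologyFunctor K)

end CDGA

namespace PolyForms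

variable (K : Type v) [Field K]

/-- Polynomial differential forms on the standard `n`-simplex. In the affine coordinates
`t₁, …, tₙ` (indexed by `Fin n`) this is the free graded commutative algebra on generators `tⱼ` of
degree `0` and `dtⱼ` of degree `1`, i.e. `K[t₁, …, tₙ] ⊗ Λ(dt₁, …, dtₙ)`; it is the quotient of the
free graded commutative algebra on `t₀, …, tₙ, dt₀, …, dtₙ` by the relations `t₀ + ⋯ + tₙ = 1` and
`dt₀ + ⋯ + dtₙ = 0`. -/
abbrev Form (n : ℕ) : Type v := MvPolynomial (Fin n) K ⊗[K] ExteriorAlgebra K (Fin n → K)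

variable {K} in
/-- The generator `dtⱼ` of the exterior algebra. -/
noncomputable abbrev dt {n : ℕ} (j : Fin n) : ExteriorAlgebra K (Fin n → K) :=
  ExteriorAlgebra.ι K (Pi.single j 1)

/-- Forms of degree `p`. -/
noncomputable def degree (n p : ℕ) : Submodule K (Form K n) :=
  Submodule.span K {x | ∃ (f : MvPolynomial (Fin n) K), ∃ w ∈ ⋀[K]^p (Fin n → K), x = f ⊗ₜ[K] w}

/-- The de Rham differential `d (f w) = ∑ⱼ (∂f/∂tⱼ) dtⱼ w` for `w` a product of `dtᵢ`'s. -/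
noncomputable def d (n : ℕ) : Form K n →ₗ[K] Form K n :=
  ∑ j : Fin n, TensorProduct.map (MvPolynomial.pderiv j).toLinearMap (LinearMap.mulLeft K (dt j))

/-- The barycentric coordinates `t₀ = 1 - ∑ⱼ tⱼ, t₁, …, tₙ`. -/
noncomputable def bary (n : ℕ) : Fin (n + 1) → MvPolynomial (Fin n) K :=
  Fin.cons (1 - ∑ j, MvPolynomial.X j) MvPolynomial.X

/-- The differentials of the barycentric coordinates as linear combinations of `dt₁, …, dtₙ`:
`dt₀ = - ∑ⱼ dtⱼ, dt₁, …, dtₙ`. -/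
def baryLin (n : ℕ) : Fin (n + 1) → (Fin n → K) :=
  Fin.cons (-∑ j, Pi.single j 1) (fun j => Pi.single j 1)

variable {m n : ℕ}

/-- Substitution `tⱼ ↦ ∑_{θ i = j} tᵢ` induced by a map of vertices `θ`. -/
noncomputable def subst (θ : Fin (m + 1) → Fin (n + 1)) :
    MvPolynomial (Fin n) K →ₐ[K] MvPolynomial (Fin m) K :=
  MvPolynomial.aeval fun j : Fin n => ∑ i with θ i = j.succ, bary K m i

/-- The substitution `dtⱼ ↦ ∑_{θ i = j} dtᵢ`. -/
def substLin (θ : Fin (m + 1) → Fin (n + 1)) : (Fin n → K) →ₗ[K] (Fin m → K) :=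
  Fintype.linearCombination K fun j : Fin n => ∑ i with θ i = j.succ, baryLin K m i

/-- Pullback of forms along the affine map of simplices determined by a map of vertices `θ`. -/
noncomputable def pullback (θ : Fin (m + 1) → Fin (n + 1)) : Form K n →ₐ[K] Form K m :=
  Algebra.TensorProduct.map (subst K θ) (ExteriorAlgebra.map (substLin K θ))

lemma pullback_tmul (θ : Fin (m + 1) → Fin (n + 1)) (f : MvPolynomial (Fin n) K)
    (w : ExteriorAlgebra K (Fin n → K)) :
    pullback K θ (f ⊗ₜ w) = subst K θ f ⊗ₜ ExteriorAlgebra.map (substLin K θ) w := rfl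

lemma d_tmul (f : MvPolynomial (Fin n) K) (w : ExteriorAlgebra K (Fin n → K)) :
    d K n (f ⊗ₜ w) = ∑ j, MvPolynomial.pderiv j f ⊗ₜ (dt j * w) := by
  simp [d, LinearMap.sum_apply]

lemma sum_bary : ∑ i, bary K n i = 1 := by
  simp [bary, Fin.sum_univ_succ]

lemma sum_baryLin : ∑ i, baryLin K n i = 0 := by
  simp [baryLin, Fin.sum_univ_succ]

lemma sum_fiber {M : Type*} [AddCommGroup M] (θ : Fin (m + 1) → Fin (n + 1))
    (b : Fin (m + 1) → M) :
    ∑ i with θ i = 0, b i = ∑ i, b i - ∑ j : Fin n, ∑ i with θ i = j.succ, b i := by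
  rw [← Finset.sum_fiberwise (s := Finset.univ) (g := θ) (f := b), Fin.sum_univ_succ]
  simp

lemma subst_bary (θ : Fin (m + 1) → Fin (n + 1)) (j : Fin (n + 1)) :
    subst K θ (bary K n j) = ∑ i with θ i = j, bary K m i := by
  refine Fin.cases ?_ (fun j => ?_) j
  · rw [sum_fiber, sum_bary]
    simp [bary, subst]
  · simp [bary, subst]

lemma substLin_single (θ : Fin (m + 1) → Fin (n + 1)) (j : Fin n) :
    substLin K θ (Pi.single j 1) = ∑ i with θ i = j.succ, baryLin K m i := by
  simp [substLin]

lemma substLin_baryLin (θ : Fin (m + 1) → Fin (n + 1)) (j : Fin (n + 1)) :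
    substLin K θ (baryLin K n j) = ∑ i with θ i = j, baryLin K m i := by
  refine Fin.cases ?_ (fun j => ?_) j
  · rw [sum_fiber, sum_baryLin]
    simp [baryLin, substLin_single]
  · simp [baryLin, substLin_single]

lemma pullback_id : pullback K (id : Fin (n + 1) → Fin (n + 1)) = AlgHom.id K _ := by
  have h1 : subst K (id : Fin (n + 1) → Fin (n + 1)) = AlgHom.id K _ := by
    refine MvPolynomial.algHom_ext fun j => ?_
    simp [subst, bary, Finset.filter_eq']
  have h2 : substLin K (id : Fin (n + 1) → Fin (n + 1)) = LinearMap.id := by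
    refine LinearMap.pi_ext' fun j => LinearMap.ext_ring ?_
    simp [substLin_single, baryLin, Finset.filter_eq']
  rw [pullback, h1, h2, ExteriorAlgebra.map_id, Algebra.TensorProduct.map_id]

lemma pullback_comp {l : ℕ} (θ : Fin (m + 1) → Fin (n + 1)) (ψ : Fin (l + 1) → Fin (m + 1)) :
    pullback K (θ ∘ ψ) = (pullback K ψ).comp (pullback K θ) := by
  have key : ∀ {M : Type v} [AddCommGroup M] (b : Fin (l + 1) → M) (j : Fin (n + 1)),
      ∑ k with θ k = j, ∑ i with ψ i = k, b i = ∑ i with (θ ∘ ψ) i = j, b i := by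
    intro M _ b j
    simp only [Finset.sum_filter, Function.comp_apply]
    have : ∀ k, (if θ k = j then ∑ i, if ψ i = k then b i else 0 else 0) =
        ∑ i, if ψ i = k then (if θ (ψ i) = j then b i else 0) else 0 := by
      intro k
      split_ifs with h
      · refine Finset.sum_congr rfl fun i _ => ?_
        split_ifs with h1 h2 <;> simp_all
      · symm
        refine Finset.sum_eq_zero fun i _ => ?_
        split_ifs with h1 h2 <;> simp_all
    simp only [this]
    rw [Finset.sum_comm]
    simp
  have h1 : subst K (θ ∘ ψ) = (subst K ψ).comp (subst K θ) := by
    refine MvPolynomial.algHom_ext fun j => ?_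
    have hX : (MvPolynomial.X j : MvPolynomial (Fin n) K) = bary K n j.succ := by simp [bary]
    rw [hX, subst_bary, AlgHom.comp_apply, subst_bary, map_sum]
    simp only [subst_bary]
    exact (key _ _).symm
  have h2 : substLin K (θ ∘ ψ) = (substLin K ψ).comp (substLin K θ) := by
    refine LinearMap.pi_ext' fun j => LinearMap.ext_ring ?_
    simp only [LinearMap.comp_apply, LinearMap.single_apply, substLin_single, map_sum,
      substLin_baryLin]
    exact (key _ _).symm
  refine Algebra.TensorProduct.ext' fun f w => ?_
  simp only [AlgHom.comp_apply, pullback_tmul, h1, h2, ← ExteriorAlgebra.map_comp_map]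

lemma pderiv_bary (i : Fin m) (k : Fin (m + 1)) :
    MvPolynomial.pderiv i (bary K m k) = MvPolynomial.C (baryLin K m k i) := by
  refine Fin.cases ?_ (fun k => ?_) k
  · simp [bary, baryLin, MvPolynomial.pderiv_X, Pi.single_apply, Finset.sum_apply]
  · simp [bary, baryLin, MvPolynomial.pderiv_X, Pi.single_apply, eq_comm, apply_ite]

/-- The chain rule for affine substitutions. -/
lemma d_subst (θ : Fin (m + 1) → Fin (n + 1)) (f : MvPolynomial (Fin n) K) :
    ∑ i, MvPolynomial.pderiv i (subst K θ f) ⊗ₜ[K] (Pi.single i 1 : Fin m → K) =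
      ∑ j, subst K θ (MvPolynomial.pderiv j f) ⊗ₜ[K] substLin K θ (Pi.single j 1) := by
  induction f using MvPolynomial.induction_on with
  | C a => simp [subst]
  | add f g hf hg =>
    simp only [map_add, TensorProduct.add_tmul, Finset.sum_add_distrib, hf, hg]
  | mul_X f k hf =>
    have hX : (MvPolynomial.X k : MvPolynomial (Fin n) K) = bary K n k.succ := by simp [bary]
    have hk : ∑ i, MvPolynomial.pderiv i (subst K θ (MvPolynomial.X k)) ⊗ₜ[K]
        (Pi.single i 1 : Fin m → K) = 1 ⊗ₜ substLin K θ (Pi.single k 1) := by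
      have : ∀ i, MvPolynomial.pderiv i (subst K θ (MvPolynomial.X k)) =
          (substLin K θ (Pi.single k 1) i) • (1 : MvPolynomial (Fin m) K) := by
        intro i
        rw [hX, subst_bary, substLin_single, map_sum]
        simp only [pderiv_bary, Finset.sum_apply, ← map_sum]
        rw [MvPolynomial.smul_eq_C_mul, mul_one]
      simp only [this, TensorProduct.smul_tmul, ← TensorProduct.tmul_sum]
      congr 1
      ext i
      simp [Finset.sum_apply, Pi.single_apply]
    have hm : ∀ (l : ℕ) (a : MvPolynomial (Fin m) K) (x : Fin l → MvPolynomial (Fin m) K)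
        (y : Fin l → Fin m → K), ∑ i, (a * x i) ⊗ₜ[K] y i = a • ∑ i, x i ⊗ₜ[K] y i := by
      intro l a x y
      simp [Finset.smul_sum, TensorProduct.smul_tmul']
    simp only [Derivation.leibniz, map_mul, map_add, smul_eq_mul, TensorProduct.add_tmul,
      Finset.sum_add_distrib, hm, hf, hk]
    congr 2
    simp only [MvPolynomial.pderiv_X, Pi.single_apply]
    rw [Finset.sum_eq_single k]
    · simp
    · intro b _ hb
      simp [hb.symm]
    · simp

lemma d_pullback (θ : Fin (m + 1) → Fin (n + 1)) (x : Form K n) :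
    d K m (pullback K θ x) = pullback K θ (d K n x) := by
  induction x using TensorProduct.induction_on with
  | zero => simp
  | add x y hx hy => simp only [map_add, hx, hy]
  | tmul f w =>
    have h := congrArg (TensorProduct.map LinearMap.id
      ((LinearMap.mulRight K (ExteriorAlgebra.map (substLin K θ) w)).comp
        (ExteriorAlgebra.ι K))) (d_subst K θ f)
    simp only [map_sum, TensorProduct.map_tmul, LinearMap.id_apply, LinearMap.comp_apply,
      LinearMap.mulRight_apply] at h
    simp only [pullback_tmul, d_tmul, map_sum, map_mul, ExteriorAlgebra.map_apply_ι, h]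

lemma pderiv_comm (i j : Fin n) (f : MvPolynomial (Fin n) K) :
    MvPolynomial.pderiv i (MvPolynomial.pderiv j f) =
      MvPolynomial.pderiv j (MvPolynomial.pderiv i f) := by
  let D (k : Fin n) : Derivation K (MvPolynomial (Fin n) K) (MvPolynomial (Fin n) K) :=
    MvPolynomial.pderiv k
  have h : ⁅D i, D j⁆ = 0 := by
    refine MvPolynomial.derivation_ext fun k => ?_
    simp only [D, Derivation.commutator_apply, MvPolynomial.pderiv_X, Pi.single_apply]
    split_ifs <;> simp
  have := DFunLike.congr_fun h f
  rwa [Derivation.commutator_apply, Derivation.zero_apply, sub_eq_zero] at this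

lemma d_d (x : Form K n) : d K n (d K n x) = 0 := by
  induction x using TensorProduct.induction_on with
  | zero => simp
  | add x y hx hy => simp only [map_add, hx, hy, add_zero]
  | tmul f w =>
    simp only [d_tmul, map_sum]
    rw [← Finset.sum_product']
    have hz : ∀ v : Fin n → K, ExteriorAlgebra.ι K v * (ExteriorAlgebra.ι K v * w) = 0 := by
      intro v
      rw [← mul_assoc, ExteriorAlgebra.ι_sq_zero, zero_mul]
    refine Finset.sum_involution (fun a _ => (a.2, a.1)) ?_ ?_ ?_ ?_
    · rintro ⟨i, j⟩ -
      have hp : MvPolynomial.pderiv i (MvPolynomial.pderiv j f) =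
          MvPolynomial.pderiv j (MvPolynomial.pderiv i f) := pderiv_comm K i j f
      have hw : dt i * (dt j * w) + dt j * (dt i * w) = 0 := by
        rw [← mul_assoc, ← mul_assoc, ← add_mul, ExteriorAlgebra.ι_add_mul_swap, zero_mul]
      rw [hp, ← TensorProduct.tmul_add, add_comm, hw, TensorProduct.tmul_zero]
    · rintro ⟨i, j⟩ - h hij
      obtain rfl : i = j := (Prod.mk.inj hij).2
      exact h (by rw [hz, TensorProduct.tmul_zero])
    · simp
    · simp

lemma ι_mul_comm {V : Type v} [AddCommGroup V] [Module K V] {q : ℕ} (v : V)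
    {b : ExteriorAlgebra K V} (hb : b ∈ ⋀[K]^q V) :
    ExteriorAlgebra.ι K v * b = (-1 : K) ^ q • (b * ExteriorAlgebra.ι K v) := by
  induction hb using Submodule.pow_induction_on_left' with
  | algebraMap r => rw [pow_zero, one_smul, Algebra.commutes]
  | add x y i hx hy ihx ihy => rw [mul_add, ihx, ihy, add_mul, smul_add]
  | mem_mul m hm i x hx ih =>
    obtain ⟨u, rfl⟩ := hm
    have h := eq_neg_of_add_eq_zero_left (ExteriorAlgebra.ι_add_mul_swap (R := K) v u)
    rw [← mul_assoc, h, neg_mul, mul_assoc, ih, mul_smul_comm, mul_assoc, pow_succ, mul_neg_one,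
      neg_smul]

lemma mul_comm_exterior {V : Type v} [AddCommGroup V] [Module K V] {p q : ℕ}
    {a b : ExteriorAlgebra K V} (ha : a ∈ ⋀[K]^p V) (hb : b ∈ ⋀[K]^q V) :
    a * b = (-1 : K) ^ (p * q) • (b * a) := by
  induction ha using Submodule.pow_induction_on_left' with
  | algebraMap r => rw [zero_mul, pow_zero, one_smul, Algebra.commutes]
  | add x y i hx hy ihx ihy => rw [add_mul, ihx, ihy, mul_add, smul_add]
  | mem_mul m hm i x hx ih =>
    obtain ⟨u, rfl⟩ := hm
    rw [mul_assoc, ih, mul_smul_comm, ← mul_assoc, ι_mul_comm K u hb, smul_mul_assoc, smul_smul,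
      mul_assoc, ← pow_add, Nat.succ_mul]

variable {K}

lemma tmul_mem_degree {p : ℕ} (f : MvPolynomial (Fin n) K) {w : ExteriorAlgebra K (Fin n → K)}
    (hw : w ∈ ⋀[K]^p (Fin n → K)) : f ⊗ₜ[K] w ∈ degree K n p :=
  Submodule.subset_span ⟨f, w, hw, rfl⟩

lemma degree_induction {p : ℕ} {C : ∀ x : Form K n, x ∈ degree K n p → Prop}
    (h0 : C 0 (zero_mem _))
    (hadd : ∀ x y hx hy, C x hx → C y hy → C (x + y) (add_mem hx hy))
    (ht : ∀ (f : MvPolynomial (Fin n) K) (w : ExteriorAlgebra K (Fin n → K))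
      (hw : w ∈ ⋀[K]^p (Fin n → K)), C (f ⊗ₜ w) (tmul_mem_degree f hw))
    {x : Form K n} (hx : x ∈ degree K n p) : C x hx := by
  suffices h : ∀ a : K, C (a • x) (Submodule.smul_mem _ a hx) by simpa using h 1
  induction hx using Submodule.span_induction with
  | mem x h =>
    obtain ⟨f, w, hw, rfl⟩ := h
    intro a
    exact ht (a • f) w hw
  | zero => intro a; simpa using h0
  | add x y hx hy ihx ihy =>
    intro a
    simp only [smul_add]
    exact hadd _ _ _ _ (ihx a) (ihy a)
  | smul b x hx ih =>
    intro a
    simp only [smul_smul]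
    exact ih (a * b)

lemma one_mem_degree : (1 : Form K n) ∈ degree K n 0 :=
  tmul_mem_degree 1 (SetLike.one_mem_graded fun i : ℕ => ⋀[K]^i (Fin n → K))

lemma mul_mem_degree {p q : ℕ} {x y : Form K n} (hx : x ∈ degree K n p) (hy : y ∈ degree K n q) :
    x * y ∈ degree K n (p + q) := by
  induction hx using degree_induction with
  | h0 => simp
  | hadd x x' _ _ h h' => rw [add_mul]; exact add_mem h h'
  | ht f w hw =>
    induction hy using degree_induction with
    | h0 => simp
    | hadd y y' _ _ h h' => rw [mul_add]; exact add_mem h h'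
    | ht g v hv =>
      rw [Algebra.TensorProduct.tmul_mul_tmul]
      exact tmul_mem_degree _ (SetLike.mul_mem_graded (A := fun i : ℕ => ⋀[K]^i (Fin n → K)) hw hv)

lemma mul_comm_form {p q : ℕ} {x y : Form K n} (hx : x ∈ degree K n p) (hy : y ∈ degree K n q) :
    x * y = (-1 : K) ^ (p * q) • (y * x) := by
  induction hx using degree_induction with
  | h0 => simp
  | hadd x x' _ _ h h' => rw [add_mul, h, h', mul_add, smul_add]
  | ht f w hw =>
    induction hy using degree_induction with
    | h0 => simp
    | hadd y y' _ _ h h' => rw [mul_add, h, h', add_mul, smul_add]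
    | ht g v hv =>
      rw [Algebra.TensorProduct.tmul_mul_tmul, Algebra.TensorProduct.tmul_mul_tmul,
        mul_comm_exterior K hw hv, TensorProduct.tmul_smul, mul_comm f g]

lemma dt_mem (j : Fin n) : (dt j : ExteriorAlgebra K (Fin n → K)) ∈ ⋀[K]^1 (Fin n → K) := by
  change _ ∈ LinearMap.range (ExteriorAlgebra.ι K) ^ 1
  rw [pow_one]
  exact LinearMap.mem_range_self _ _

lemma d_mem_degree {p : ℕ} {x : Form K n} (hx : x ∈ degree K n p) :
    d K n x ∈ degree K n (p + 1) := by
  induction hx using degree_induction with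
  | h0 => simp
  | hadd x x' _ _ h h' => rw [map_add]; exact add_mem h h'
  | ht f w hw =>
    rw [d_tmul, add_comm]
    exact sum_mem fun j _ => tmul_mem_degree _
      (SetLike.mul_mem_graded (A := fun i : ℕ => ⋀[K]^i (Fin n → K)) (dt_mem j) hw)

lemma pullback_mem_degree (θ : Fin (m + 1) → Fin (n + 1)) {p : ℕ} {x : Form K n}
    (hx : x ∈ degree K n p) : pullback K θ x ∈ degree K m p := by
  induction hx using degree_induction with
  | h0 => simp
  | hadd x x' _ _ h h' => rw [map_add]; exact add_mem h h'
  | ht f w hw =>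
    rw [pullback_tmul]
    refine tmul_mem_degree _ ?_
    have h := Submodule.mem_map_of_mem (f := (ExteriorAlgebra.map (substLin K θ)).toLinearMap) hw
    rw [Submodule.map_pow] at h
    refine SetLike.le_def.1 (pow_le_pow_left' ?_ p) h
    rintro _ ⟨_, ⟨v, rfl⟩, rfl⟩
    exact ⟨substLin K θ v, by simp⟩

lemma leibniz {p : ℕ} {x : Form K n} (hx : x ∈ degree K n p) (y : Form K n) :
    d K n (x * y) = d K n x * y + (-1 : K) ^ p • (x * d K n y) := by
  induction hx using degree_induction with
  | h0 => simp
  | hadd x x' _ _ h h' => simp only [add_mul, map_add, h, h', smul_add]; abel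
  | ht f w hw =>
    induction y using TensorProduct.induction_on with
    | zero => simp
    | add y y' h h' => simp only [mul_add, map_add, h, h', smul_add]; abel
    | tmul g v =>
      simp only [Algebra.TensorProduct.tmul_mul_tmul, d_tmul, Finset.sum_mul, Finset.mul_sum,
        Finset.smul_sum, ← Finset.sum_add_distrib]
      refine Finset.sum_congr rfl fun j _ => ?_
      have hj : w * (dt j * v) = (-1 : K) ^ p • (dt j * (w * v)) := by
        have := mul_comm_exterior K hw (dt_mem j)
        rw [mul_one] at this
        rw [← mul_assoc, this, smul_mul_assoc, mul_assoc]
      rw [hj, TensorProduct.tmul_smul, smul_smul, ← mul_pow, neg_one_mul, neg_neg, one_pow,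
        one_smul, Derivation.leibniz, TensorProduct.add_tmul, smul_eq_mul, smul_eq_mul, mul_assoc,
        mul_comm g, add_comm]

end PolyForms

namespace PolyForms

open Opposite

variable (K : Type v) [Field K] (S : SSet.{u})

/-- All families assigning to each simplex of `S` a polynomial form on the standard simplex of
the same dimension. -/
abbrev Family : Type (max u v) := ∀ n : SimplexCategory, S.obj (op n) → Form K n.len

/-- Polynomial forms of degree `p` on the simplicial set `S`: families of forms of degree `p` that
are compatible with all simplicial operators, i.e. simplicial maps from `S` to the simplicial vector
space `n ↦ (degree p forms on the n-simplex)`. -/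
def forms (p : ℕ) : Submodule K (Family K S) where
  carrier := {ω | (∀ n σ, ω n σ ∈ degree K n.len p) ∧
    ∀ (m n : SimplexCategory) (θ : m ⟶ n) (σ : S.obj (op n)),
      ω m (S.map θ.op σ) = pullback K θ.toOrderHom (ω n σ)}
  add_mem' := fun ha hb =>
    ⟨fun n σ => add_mem (ha.1 n σ) (hb.1 n σ), fun m n θ σ => by
      simp only [Pi.add_apply, map_add, ha.2 m n θ σ, hb.2 m n θ σ]⟩
  zero_mem' := ⟨fun _ _ => zero_mem _, fun m n θ σ => by simp⟩
  smul_mem' := fun c a ha =>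
    ⟨fun n σ => Submodule.smul_mem _ c (ha.1 n σ), fun m n θ σ => by
      simp only [Pi.smul_apply, map_smul, ha.2 m n θ σ]⟩

variable {K S}

lemma forms_ext {p : ℕ} {a b : forms K S p} (h : ∀ n σ, a.1 n σ = b.1 n σ) : a = b :=
  Subtype.ext (funext fun n => funext fun σ => h n σ)

/-- The differential, applied simplexwise. -/
noncomputable def formsD (p : ℕ) : forms K S p →ₗ[K] forms K S (p + 1) where
  toFun a := ⟨fun n σ => d K n.len (a.1 n σ), fun n σ => d_mem_degree (a.2.1 n σ),
    fun m n θ σ => (congrArg (d K m.len) (a.2.2 m n θ σ)).trans (d_pullback K _ _)⟩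
  map_add' a b := forms_ext fun n σ => (d K n.len).map_add (a.1 n σ) (b.1 n σ)
  map_smul' c a := forms_ext fun n σ => (d K n.len).map_smul c (a.1 n σ)

/-- The wedge product, applied simplexwise. -/
noncomputable def formsMul {p q n : ℕ} (h : p + q = n) :
    forms K S p →ₗ[K] forms K S q →ₗ[K] forms K S n :=
  LinearMap.mk₂ K
    (fun a b => ⟨fun n σ => a.1 n σ * b.1 n σ,
      fun n σ => h ▸ mul_mem_degree (a.2.1 n σ) (b.2.1 n σ),
      fun m n θ σ => (congrArg₂ (· * ·) (a.2.2 m n θ σ) (b.2.2 m n θ σ)).trans (map_mul _ _ _).symm⟩)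
    (fun _ _ _ => forms_ext fun _ _ => add_mul _ _ _)
    (fun c a b => forms_ext fun n σ => smul_mul_assoc c (a.1 n σ) (b.1 n σ))
    (fun _ _ _ => forms_ext fun _ _ => mul_add _ _ _)
    (fun c a b => forms_ext fun n σ => mul_smul_comm c (a.1 n σ) (b.1 n σ))

lemma formsD_apply {p : ℕ} (a : forms K S p) (n : SimplexCategory) (σ : S.obj (op n)) :
    (formsD p a).1 n σ = d K n.len (a.1 n σ) := rfl

lemma formsMul_apply {p q r : ℕ} (h : p + q = r) (a : forms K S p) (b : forms K S q)
    (n : SimplexCategory) (σ : S.obj (op n)) :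
    (formsMul h a b).1 n σ = a.1 n σ * b.1 n σ := rfl

variable (K S)

/-- The algebra `A_PL(S; K)` of polynomial differential forms on a simplicial set, with operations
defined simplexwise. -/
noncomputable def aplSSet : CDGA.{v, max u v} K where
  A := fun p => forms K S p
  d := formsD
  mul := formsMul
  one := ⟨fun _ _ => 1, fun _ _ => one_mem_degree, fun _ _ _ _ => (map_one _).symm⟩
  one_mul a := forms_ext fun n σ => _root_.one_mul (a.1 n σ)
  mul_one a := forms_ext fun n σ => _root_.mul_one (a.1 n σ)
  mul_assoc _ _ _ _ a b c := forms_ext fun n σ =>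
    _root_.mul_assoc (a.1 n σ) (b.1 n σ) (c.1 n σ)
  mul_comm _ _ a b := forms_ext fun n σ => mul_comm_form (a.2.1 n σ) (b.2.1 n σ)
  d_d a := forms_ext fun n σ => d_d K (a.1 n σ)
  leibniz _ _ _ a b := forms_ext fun n σ => leibniz (a.2.1 n σ) (b.1 n σ)

/-- Functoriality of polynomial forms in the simplicial set. -/
noncomputable def aplSSetFunctor : SSet.{u}ᵒᵖ ⥤ CDGA.{v, max u v} K where
  obj S := aplSSet K S.unop
  map g :=
    { f := fun _ =>
        { toFun := fun a => ⟨fun n σ => a.1 n (g.unop.app (op n) σ), fun n _ => a.2.1 n _,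
            fun m n θ σ =>
              (congrArg (a.1 m) (NatTrans.naturality_apply g.unop θ.op σ)).trans (a.2.2 m n θ _)⟩
          map_add' := fun _ _ => rfl
          map_smul' := fun _ _ => rfl }
      map_d := fun _ => rfl
      map_mul := fun _ _ _ => rfl
      map_one := rfl }
  map_id _ := rfl
  map_comp _ _ := rfl

end PolyForms

/-- Sullivan's functor `A_PL(-; K)` of piecewise polynomial forms on topological spaces: polynomial
forms on the singular simplicial set. -/
noncomputable def apl (K : Type v) [Field K] : TopCat.{u}ᵒᵖ ⥤ CDGA.{v, max u v} K :=
  TopCat.toSSet.op ⋙ PolyForms.aplSSetFunctor K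

/-- A diagram of spaces `F` is `K`-formal if the diagram of CDGAs `A_PL(F; K)` is formal. -/
def IsFormalDiagram (K : Type v) [Field K] {J : Type*} [Category* J] (F : J ⥤ TopCat.{u}) : Prop :=
  CDGA.IsFormal (F.op ⋙ apl K)

/-! ### Spectral sequence of a filtered chain complex -/

/-- A chain complex of `R`-modules with a decreasing filtration by subcomplexes
`⋯ ⊇ F p ⊇ F (p + 1) ⊇ ⋯`. -/
structure FilteredComplex (R : Type v) [CommRing R] where
  C : ChainComplex (ModuleCat.{w} R) ℤ
  F (p n : ℤ) : Submodule R (C.X n)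
  F_succ_le (p n : ℤ) : F (p + 1) n ≤ F p n
  d_mem (p i j : ℤ) (x : C.X i) : x ∈ F p i → (C.d i j).hom x ∈ F p j

namespace FilteredComplex

variable {R : Type v} [CommRing R] (T : FilteredComplex.{v, w} R)

lemma d_d_apply (i j k : ℤ) (x : T.C.X i) : (T.C.d j k).hom ((T.C.d i j).hom x) = 0 := by
  have h := T.C.d_comp_d i j k
  exact congrArg (fun f => f.hom x) h

/-- `Z^r_p = {x ∈ F^p | d x ∈ F^{p+r}}` in total degree `n`. -/
def Z (r p n : ℤ) : Submodule R (T.C.X n) :=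
  T.F p n ⊓ (T.F (p + r) (n - 1)).comap (T.C.d n (n - 1)).hom

/-- `Z^{r-1}_{p+1} + d Z^{r-1}_{p-r+1}` in total degree `n`. -/
def B (r p n : ℤ) : Submodule R (T.C.X n) :=
  T.Z (r - 1) (p + 1) n ⊔ (T.Z (r - 1) (p - r + 1) (n + 1)).map (T.C.d (n + 1) n).hom

/-- The term `E^r_p = Z^r_p / (Z^{r-1}_{p+1} + d Z^{r-1}_{p-r+1})` of the spectral sequence, in
filtration degree `p` and total degree `n`, for `r ≥ 0`. -/
abbrev E (r p n : ℤ) : Type w := T.Z r p n ⧸ (T.B r p n).comap (T.Z r p n).subtype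

lemma d_mem_Z (r p n : ℤ) {x : T.C.X n} (hx : x ∈ T.Z r p n) :
    (T.C.d n (n - 1)).hom x ∈ T.Z r (p + r) (n - 1) := by
  refine ⟨hx.2, ?_⟩
  change (T.C.d (n - 1) (n - 1 - 1)).hom ((T.C.d n (n - 1)).hom x) ∈ T.F (p + r + r) (n - 1 - 1)
  rw [d_d_apply]
  exact zero_mem _

lemma d_mem_B (r p n : ℤ) {x : T.C.X n} (hx : x ∈ T.B r p n) :
    (T.C.d n (n - 1)).hom x ∈ T.B r (p + r) (n - 1) := by
  obtain ⟨y, hy, _, ⟨z, hz, rfl⟩, rfl⟩ := Submodule.mem_sup.1 hx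
  rw [map_add, d_d_apply, add_zero]
  refine Submodule.mem_sup_right ?_
  have h1 : p + r - r + 1 = p + 1 := by ring
  have h2 : n - 1 + 1 = n := by ring
  rw [h1, h2]
  exact ⟨y, hy, rfl⟩

/-- The differential `d^r : E^r_p → E^r_{p+r}`, of total degree `-1`, induced by that of the complex. -/
def dE (r p n : ℤ) : T.E r p n →ₗ[R] T.E r (p + r) (n - 1) :=
  Submodule.mapQ _ _ ((T.C.d n (n - 1)).hom.restrict fun _ hx => T.d_mem_Z r p n hx)
    (fun _ hx => T.d_mem_B r p n hx)

/-- The spectral sequence collapses at the page `E^s`: all differentials `d^r`, `r ≥ s`, vanish. -/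
def CollapsesAt (s : ℤ) : Prop := ∀ r p n : ℤ, s ≤ r → T.dE r p n = 0

end FilteredComplex

/-! ### The spectral sequence of a cosimplicial chain complex -/

namespace CosimplicialComplex

open CategoryTheory.CosimplicialObject AlgebraicTopology

variable {R : Type v} [CommRing R]
  (V : CosimplicialObject (ChainComplex (ModuleCat.{w} R) ℕ))

/-- The conormalization `N^m(V)_q = ⋂ⱼ ker (sʲ : V^m_q → V^{m-1}_q)`. -/
def conorm : (m q : ℕ) → Submodule R ((V.obj (.mk m)).X q)
  | 0, _ => ⊤
  | m + 1, q => ⨅ j : Fin (m + 1), LinearMap.ker ((V.σ j).f q).hom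

/-- The alternating sum of cofaces `δ = ∑ᵢ (-1)ⁱ dⁱ : V^m_q → V^{m'}_q` if `m' = m + 1`, and `0`
otherwise. -/
def coface (m m' q : ℕ) : (V.obj (.mk m)).X q →ₗ[R] (V.obj (.mk m')).X q :=
  ((((alternatingCofaceMapComplex _).obj V).d m m').f q).hom

/-- The internal differential `∂ : V^m_q → V^m_{q'}` if `q = q' + 1`, and `0` otherwise. -/
def bdry (m q q' : ℕ) : (V.obj (.mk m)).X q →ₗ[R] (V.obj (.mk m)).X q' := ((V.obj (.mk m)).d q q').hom

lemma sum_zsmul_f_apply {A B : ChainComplex (ModuleCat.{w} R) ℕ} {k : ℕ} (c : Fin k → ℤ)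
    (f : Fin k → (A ⟶ B)) (q : ℕ) (x : A.X q) :
    ((∑ i, c i • f i).f q).hom x = ∑ i, c i • ((f i).f q).hom x := by
  have h : (∑ i, c i • f i).f q = ∑ i, c i • (f i).f q := by
    have := map_sum (HomologicalComplex.Hom.fAddMonoidHom (C₁ := A) (C₂ := B) q)
      (fun i => c i • f i) Finset.univ
    refine this.trans (Finset.sum_congr rfl fun i _ => ?_)
    exact map_zsmul (HomologicalComplex.Hom.fAddMonoidHom (C₁ := A) (C₂ := B) q) (c i) (f i)
  rw [h, ModuleCat.hom_sum, LinearMap.sum_apply]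
  rfl

lemma coface_succ (m q : ℕ) (x : (V.obj (.mk m)).X q) :
    coface V m (m + 1) q x = ∑ i : Fin (m + 2), (-1 : ℤ) ^ (i : ℕ) • ((V.δ i).f q).hom x := by
  have h : ((alternatingCofaceMapComplex _).obj V).d m (m + 1) =
      ∑ i : Fin (m + 2), (-1 : ℤ) ^ (i : ℕ) • V.δ i :=
    CochainComplex.of_d (fun n => V.obj (.mk n)) (AlternatingCofaceMapComplex.objD V) m
  have h2 := congrArg (fun f => (f.f q).hom x) h
  exact h2.trans (sum_zsmul_f_apply _ _ q x)

lemma coface_eq_zero {m m' : ℕ} (h : m + 1 ≠ m') (q : ℕ) (x : (V.obj (.mk m)).X q) :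
    coface V m m' q x = 0 :=
  congrArg (fun f => (f.f q).hom x)
    (HomologicalComplex.shape ((alternatingCofaceMapComplex _).obj V) m m' h)

lemma coface_coface (l m n q : ℕ) (x : (V.obj (.mk l)).X q) :
    coface V m n q (coface V l m q x) = 0 := by
  have h := congrArg (fun f => (f.f q).hom x) (((alternatingCofaceMapComplex _).obj V).d_comp_d l m n)
  exact h

lemma bdry_bdry (m q q' q'' : ℕ) (x : (V.obj (.mk m)).X q) :
    bdry V m q' q'' (bdry V m q q' x) = 0 :=
  congrArg (fun f => f.hom x) ((V.obj (.mk m)).d_comp_d q q' q'')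

lemma bdry_coface (m m' q q' : ℕ) (x : (V.obj (.mk m)).X q) :
    bdry V m' q q' (coface V m m' q x) = coface V m m' q' (bdry V m q q' x) :=
  congrArg (fun f => f.hom x) ((((alternatingCofaceMapComplex _).obj V).d m m').comm q q')

lemma mem_conorm_succ {m q : ℕ} {x : (V.obj (.mk (m + 1))).X q} :
    x ∈ conorm V (m + 1) q ↔ ∀ j : Fin (m + 1), ((V.σ j).f q).hom x = 0 := by
  simp [conorm, Submodule.mem_iInf]

lemma bdry_mem_conorm (m q q' : ℕ) {x : (V.obj (.mk m)).X q} (hx : x ∈ conorm V m q) :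
    bdry V m q q' x ∈ conorm V m q' := by
  cases m with
  | zero => trivial
  | succ m =>
    rw [mem_conorm_succ] at hx ⊢
    intro j
    have h := congrArg (fun f => f.hom x) ((V.σ j).comm q q')
    refine h.symm.trans ?_
    change ((V.obj (.mk m)).d q q').hom (((V.σ j).f q).hom x) = 0
    rw [hx j, map_zero]

lemma σ_δ_eq_zero {m q : ℕ} {x : (V.obj (.mk m)).X q} (hx : x ∈ conorm V m q) (j : Fin (m + 1))
    (i : Fin (m + 2)) (h1 : i ≠ j.castSucc) (h2 : i ≠ j.succ) :
    ((V.σ j).f q).hom (((V.δ i).f q).hom x) = 0 := by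
  cases m with
  | zero =>
    exfalso
    fin_cases j
    fin_cases i <;> simp at h1 h2
  | succ m =>
    rw [mem_conorm_succ] at hx
    rcases lt_or_gt_of_ne h1 with h | h
    · obtain ⟨j, rfl⟩ : ∃ j' : Fin (m + 1), j = j'.succ :=
        Fin.exists_succ_eq.2 (by rintro rfl; simp at h) |>.imp fun _ h => h.symm
      obtain ⟨i, rfl⟩ : ∃ i' : Fin (m + 2), i = i'.castSucc :=
        ⟨i.castPred (by rintro rfl; exact absurd h (by simp [Fin.le_last])), by simp⟩
      have hij : i ≤ j.castSucc := by
        simp only [Fin.lt_def, Fin.le_def, Fin.val_castSucc, Fin.val_succ] at h ⊢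
        omega
      have e := congrArg (fun f => (f.f q).hom x) (V.δ_comp_σ_of_le hij)
      refine e.trans ?_
      change ((V.δ i).f q).hom (((V.σ j).f q).hom x) = 0
      rw [hx j, map_zero]
    · obtain ⟨i, rfl⟩ : ∃ i' : Fin (m + 2), i = i'.succ :=
        Fin.exists_succ_eq.2 (by rintro rfl; simp at h) |>.imp fun _ h => h.symm
      have hij : (j : ℕ) < i := by
        simp only [Fin.lt_def, Fin.val_castSucc, Fin.val_succ, ne_eq, Fin.ext_iff] at h h2
        omega
      obtain ⟨j, rfl⟩ : ∃ j' : Fin (m + 1), j = j'.castSucc :=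
        ⟨j.castPred (by rintro rfl; simp only [Fin.val_last] at hij; omega), by simp⟩
      have e := congrArg (fun f => (f.f q).hom x)
        (V.δ_comp_σ_of_gt (i := i) (j := j) (by simpa [Fin.lt_def] using hij))
      refine e.trans ?_
      change ((V.δ i).f q).hom (((V.σ j).f q).hom x) = 0
      rw [hx j, map_zero]

lemma coface_mem_conorm (m m' q : ℕ) {x : (V.obj (.mk m)).X q} (hx : x ∈ conorm V m q) :
    coface V m m' q x ∈ conorm V m' q := by
  by_cases hm : m + 1 = m'
  · subst hm
    rw [mem_conorm_succ]
    intro j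
    rw [coface_succ, map_sum]
    simp only [map_zsmul]
    rw [Finset.sum_eq_add j.castSucc j.succ (by simp [Fin.ext_iff])
      (fun i _ hi => by rw [σ_δ_eq_zero V hx j i hi.1 hi.2, smul_zero]) (by simp) (by simp)]
    have e1 : ((V.σ j).f q).hom (((V.δ j.castSucc).f q).hom x) = x :=
      congrArg (fun f => (f.f q).hom x) (V.δ_comp_σ_self (i := j))
    have e2 : ((V.σ j).f q).hom (((V.δ j.succ).f q).hom x) = x :=
      congrArg (fun f => (f.f q).hom x) (V.δ_comp_σ_succ (i := j))
    rw [e1, e2, Fin.val_castSucc, Fin.val_succ, pow_succ, mul_neg_one, neg_smul, add_neg_cancel]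
  · rw [coface_eq_zero V hm]
    exact zero_mem _

/-- The product of all the modules `V^m_q`. -/
abbrev Components : Type w := ∀ m q : ℕ, (V.obj (.mk m)).X q

/-- The total differential, `(D x)_{m,q} = ∂ x_{m,q+1} + (-1)^{m+q} δ x_{m-1,q}`
(for `m = 0` the second term is zero, as `coface V 0 0 q = 0`). -/
def totD : Components V →ₗ[R] Components V where
  toFun x m q := bdry V m (q + 1) q (x m (q + 1)) + (-1 : ℤ) ^ (m + q) • coface V (m - 1) m q (x (m - 1) q)
  map_add' x y := by
    funext m q
    simp only [Pi.add_apply, map_add, smul_add]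
    abel
  map_smul' c x := by
    funext m q
    simp only [Pi.smul_apply, map_smul, RingHom.id_apply, smul_add]
    rw [smul_comm]

lemma totD_apply (x : Components V) (m q : ℕ) : totD V x m q =
    bdry V m (q + 1) q (x m (q + 1)) + (-1 : ℤ) ^ (m + q) • coface V (m - 1) m q (x (m - 1) q) := rfl

lemma totD_totD (x : Components V) : totD V (totD V x) = 0 := by
  funext m q
  simp only [totD_apply, map_add, map_zsmul, bdry_bdry, coface_coface, bdry_coface, smul_zero,
    zero_add, add_zero, Pi.zero_apply]
  rcases m with _ | m
  · simp [coface_eq_zero V (m := 0) (m' := 0) (by simp)]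
  · simp only [← add_smul]
    have h : (-1 : ℤ) ^ (m + 1 + (q + 1)) + (-1) ^ (m + 1 + q) = 0 := by
      rw [← add_assoc, pow_succ]; ring
    rw [h, zero_smul]

/-- Total degree `n`: the submodule `∏_{m ≥ 0} N^m(V)_{m+n}` of the product. -/
def totX (n : ℤ) : Submodule R (Components V) where
  carrier := {x | ∀ m q, x m q ∈ conorm V m q ∧ ((q : ℤ) ≠ m + n → x m q = 0)}
  add_mem' hx hy m q := ⟨add_mem (hx m q).1 (hy m q).1, fun h => by
    rw [Pi.add_apply, Pi.add_apply, (hx m q).2 h, (hy m q).2 h, add_zero]⟩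
  zero_mem' _ _ := ⟨zero_mem _, fun _ => rfl⟩
  smul_mem' c _ hx m q := ⟨Submodule.smul_mem _ c (hx m q).1, fun h => by
    rw [Pi.smul_apply, Pi.smul_apply, (hx m q).2 h, smul_zero]⟩

lemma totD_mem {i j : ℤ} (hij : j + 1 = i) {x : Components V} (hx : x ∈ totX V i) :
    totD V x ∈ totX V j := by
  intro m q
  refine ⟨add_mem (bdry_mem_conorm V _ _ _ (hx _ _).1)
    (zsmul_mem (coface_mem_conorm V _ _ _ (hx _ _).1) _), fun h => ?_⟩
  rw [totD_apply, (hx m (q + 1)).2 (by push_cast; omega), map_zero, zero_add]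
  rcases m with _ | m
  · have h0 : coface V 0 0 q (x 0 q) = 0 := coface_eq_zero V (by simp) q _
    exact (congrArg _ h0).trans (smul_zero _)
  · have h0 : x m q = 0 := (hx m q).2 (by push_cast at h; omega)
    have h1 : coface V m (m + 1) q (x m q) = 0 := by rw [h0, map_zero]
    exact (congrArg _ h1).trans (smul_zero _)

open Classical in
/-- The total complex `T_n = ∏_{m ≥ 0} N^m(V)_{m+n}` of the conormalized double complex. -/
noncomputable def tot : ChainComplex (ModuleCat.{w} R) ℤ where
  X n := ModuleCat.of R (totX V n)
  d i j := if h : j + 1 = i then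
    ModuleCat.ofHom ((totD V).restrict fun _ hx => totD_mem V h hx) else 0
  shape i j h := dif_neg h
  d_comp_d' i j k hij hjk := by
    have hij' : j + 1 = i := hij
    have hjk' : k + 1 = j := hjk
    rw [dif_pos hij', dif_pos hjk']
    refine ModuleCat.hom_ext (LinearMap.ext fun x => Subtype.ext ?_)
    exact totD_totD V x.1

lemma tot_d_apply {i j : ℤ} (h : j + 1 = i) (x : totX V i) :
    (((tot V).d i j).hom x : totX V j).1 = totD V x.1 := by
  simp only [tot]
  rw [dif_pos h]
  rfl

/-- The total complex, filtered by cosimplicial degree: `F^p` consists of the elements whose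
components of cosimplicial degree `m < p` vanish. -/
noncomputable def filtered : FilteredComplex.{v, w} R where
  C := tot V
  F p n := Submodule.comap (totX V n).subtype
    { carrier := {x : Components V | ∀ m q : ℕ, (m : ℤ) < p → x m q = 0}
      add_mem' := fun hx hy m q h => by
        rw [Pi.add_apply, Pi.add_apply, hx m q h, hy m q h, add_zero]
      zero_mem' := fun _ _ _ => rfl
      smul_mem' := fun c x hx m q h => by
        rw [Pi.smul_apply, Pi.smul_apply, hx m q h, smul_zero] }
  F_succ_le p n x hx m q h := hx m q (by omega)
  d_mem p i j x hx m q h := by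
    by_cases hij : j + 1 = i
    · change (((tot V).d i j).hom x : totX V j).1 m q = 0
      have hx' : ∀ m q : ℕ, (m : ℤ) < p → x.1 m q = 0 := hx
      rw [tot_d_apply V hij x, totD_apply, hx' m _ h, hx' (m - 1) _ (by omega)]
      simp
    · have h0 : (tot V).d i j = 0 := HomologicalComplex.shape _ _ _ hij
      rw [h0]
      rfl

end CosimplicialComplex

/-! ### The homology Bousfield-Kan spectral sequence -/

/-- The free module functor `Y ↦ R^(Y)` (with no constraint on the universes of `Y` and `R`). -/
noncomputable def freeModuleFunctor (R : Type v) [CommRing R] :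
    Type u ⥤ ModuleCat.{max u v} R where
  obj Y := ModuleCat.of R (Y →₀ R)
  map f := ModuleCat.ofHom (Finsupp.lmapDomain R R f)
  map_id _ := ModuleCat.hom_ext (Finsupp.lmapDomain_id R R)
  map_comp f g := ModuleCat.hom_ext (Finsupp.lmapDomain_comp R R f g)

/-- The normalized singular chain complex of a space with coefficients in `R`: the normalized chain
complex of the free simplicial `R`-module on the singular simplicial set. -/
noncomputable def normalizedSingularChains (R : Type v) [CommRing R] :
    TopCat.{u} ⥤ ChainComplex (ModuleCat.{max u v} R) ℕ :=
  TopCat.toSSet ⋙ (SimplicialObject.whiskering _ _).obj (freeModuleFunctor.{u, v} R) ⋙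
    AlgebraicTopology.normalizedMooreComplex (ModuleCat.{max u v} R)

/-- The homology Bousfield-Kan spectral sequence of a cosimplicial space `X` with coefficients in
`R` is the spectral sequence of this filtered complex: the total complex
`T_n = ∏_{m ≥ 0} N^m N_{m+n}(X; R)`, filtered by cosimplicial degree. -/
noncomputable def bousfieldKan (R : Type v) [CommRing R] (X : CosimplicialObject TopCat.{u}) :
    FilteredComplex.{v, max u v} R :=
  CosimplicialComplex.filtered
    (((CosimplicialObject.whiskering _ _).obj (normalizedSingularChains.{u, v} R)).obj X)

/-! ### Simplicial cochain complexes -/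

/-! Formality is exploited in cohomology. In the double complex of a simplicial CDGA, a second-page
class is permanent if some representative `a` starts a staircase `δ a = d b`, `δ b = d b'`, … that
ends in simplicial or cohomological degree 0. If `d = 0`, then `δ a` being exact means `δ a = 0`, so
every second-page class is permanent. This property passes in both directions along degreewise
quasi-isomorphisms (`Hom.IsQuasiIso.permanent_iff`), hence along the zig-zag, and so it holds for
`A_PL(X)` (`CDGA.IsFormal.permanent`).

It is carried to singular cochains without integrating forms. Polynomial forms and simplicial
cochains on the standard simplices are two injective resolutions of the constant simplicial vector
space (`plResolution`, `cochainResolution`), hence homotopy equivalent. Taking simplicial maps out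
of the singular sets of the `X^m` turns this into a homotopy equivalence of complexes of simplicial
groups. For forms, injectivity comes from a simplicial contraction and exactness from the Poincaré
lemma.

Homology is reached by duality. Let the total boundary `D x` vanish in columns below `m`, and let
`w` be one of its components in column `m`. Moving along a staircase shows that `w` pairs to zero
with permanent classes, hence with every second-page cocycle (`pair_totD_eq_zero`). A functional
that kills `im ∂` and `δ (ker ∂)` gives second-page cocycles, so `w` lies in `im ∂ + δ (ker ∂)`
(`totD_mem_of_permanent`), that is, `w` is zero on the second page. Such a leading term can be
removed by changing `x` in filtration at least `m - 1`. For `r ≥ 2` and `m = p + r` this is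
filtration at least `p + 1`, which makes `d^r` vanish (`collapsesAt_two`). Only leading terms enter,
so neither convergence nor finiteness is needed.

The fields `L` and `K` need not map to each other. Chains over `L` are paired with cochains over `K`
through additive maps `L → K`; coordinates in a rational basis of `L` suffice to detect vanishing
(`sum_mul_eq_zero_of_forall_addMonoidHom`). -/

/-- The double complex of abelian groups underlying a simplicial cochain complex: `A m q` is the group in
simplicial degree `m` and cohomological degree `q`. -/
structure SimplicialCochain where
  A : ℕ → ℕ → Type w
  [addCommGroup : ∀ m q, AddCommGroup (A m q)]
  d (m q : ℕ) : A m q →+ A m (q + 1)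
  δ (m q : ℕ) : A (m + 1) q →+ A m q
  d_d (m q : ℕ) (a : A m q) : d m (q + 1) (d m q a) = 0
  δ_δ (m q : ℕ) (a : A (m + 2) q) : δ m q (δ (m + 1) q a) = 0
  d_δ (m q : ℕ) (a : A (m + 1) q) : d m q (δ m q a) = δ m (q + 1) (d (m + 1) q a)

namespace SimplicialCochain

attribute [instance] SimplicialCochain.addCommGroup

/-- The coboundaries; there are none in cohomological degree `0`. -/
def cob (A : SimplicialCochain.{w}) (m : ℕ) : ∀ q, AddSubgroup (A.A m q)
  | 0 => ⊥
  | q + 1 => (A.d m q).range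

/-- An element `a` of degree `(m, q)` descends if there are `aₘ = a, aₘ₋₁, aₘ₋₂, …` such that
`δ aᵢ₊₁ = d aᵢ`. -/
def Descends (A : SimplicialCochain.{w}) : ∀ m q, A.A m q → Prop
  | 0, _, _ => True
  | m + 1, 0, a => A.δ m 0 a = 0
  | m + 1, q + 1, a => ∃ b : A.A m q, A.δ m (q + 1) a = A.d m q b ∧ A.Descends m q b

/-- A cocycle represents a class on the second page if its image under `δ` is exact. -/
def IsSecond (A : SimplicialCochain.{w}) : ∀ m q, A.A m q → Prop
  | 0, q, a => A.d 0 q a = 0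
  | m + 1, q, a => A.d (m + 1) q a = 0 ∧ A.δ m q a ∈ A.cob m q

/-- Every class on the second page is represented by a cocycle which descends. -/
def Permanent (A : SimplicialCochain.{w}) : Prop :=
  ∀ m q (a : A.A m q), A.IsSecond m q a →
    ∃ c : A.A (m + 1) q, A.d (m + 1) q c = 0 ∧ ∃ b ∈ A.cob m q, A.Descends m q (a + b + A.δ m q c)

/-- Morphisms of simplicial cochain complexes. -/
structure Hom (A B : SimplicialCochain.{w}) where
  f (m q : ℕ) : A.A m q →+ B.A m q
  map_d (m q : ℕ) (a : A.A m q) : f m (q + 1) (A.d m q a) = B.d m q (f m q a)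
  map_δ (m q : ℕ) (a : A.A (m + 1) q) : f m q (A.δ m q a) = B.δ m q (f (m + 1) q a)

/-- Morphisms inducing isomorphisms on the cohomology in each simplicial degree. -/
structure Hom.IsQuasiIso {A B : SimplicialCochain.{w}} (F : Hom A B) : Prop where
  inj (m q : ℕ) (a : A.A m q) : A.d m q a = 0 → F.f m q a ∈ B.cob m q → a ∈ A.cob m q
  surj (m q : ℕ) (b : B.A m q) : B.d m q b = 0 →
    ∃ a : A.A m q, A.d m q a = 0 ∧ b - F.f m q a ∈ B.cob m q

variable {A B : SimplicialCochain.{w}}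

lemma d_of_mem_cob {m q : ℕ} {a : A.A m q} (h : a ∈ A.cob m q) : A.d m q a = 0 := by
  cases q with
  | zero =>
    obtain rfl : a = 0 := h
    exact map_zero _
  | succ q =>
    obtain ⟨b, rfl⟩ := h
    exact A.d_d _ _ _

lemma δ_mem_cob {m q : ℕ} {a : A.A (m + 1) q} (h : a ∈ A.cob (m + 1) q) : A.δ m q a ∈ A.cob m q := by
  cases q with
  | zero =>
    obtain rfl : a = 0 := h
    rw [map_zero]
    exact zero_mem _
  | succ q =>
    obtain ⟨b, rfl⟩ := h
    exact ⟨A.δ m q b, A.d_δ _ _ _⟩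

lemma Hom.map_mem_cob (F : Hom A B) {m q : ℕ} {a : A.A m q} (h : a ∈ A.cob m q) :
    F.f m q a ∈ B.cob m q := by
  cases q with
  | zero =>
    obtain rfl : a = 0 := h
    rw [map_zero]
    exact zero_mem _
  | succ q =>
    obtain ⟨b, rfl⟩ := h
    exact ⟨F.f m q b, (F.map_d _ _ _).symm⟩

lemma IsSecond.d_eq_zero {m q : ℕ} {a : A.A m q} (h : A.IsSecond m q a) : A.d m q a = 0 := by
  cases m with
  | zero => exact h
  | succ m => exact h.1

lemma Hom.isSecond (F : Hom A B) {m q : ℕ} {a : A.A m q} (h : A.IsSecond m q a) :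
    B.IsSecond m q (F.f m q a) := by
  have hd : B.d m q (F.f m q a) = 0 := by rw [← F.map_d, h.d_eq_zero, map_zero]
  cases m with
  | zero => exact hd
  | succ m =>
    refine ⟨hd, ?_⟩
    rw [← F.map_δ]
    exact F.map_mem_cob h.2

lemma Hom.descends (F : Hom A B) {m q : ℕ} {a : A.A m q} (h : A.Descends m q a) :
    B.Descends m q (F.f m q a) := by
  induction m generalizing q with
  | zero => trivial
  | succ m ih =>
    cases q with
    | zero =>
      change B.δ m 0 _ = 0
      rw [← F.map_δ, show A.δ m 0 a = 0 from h, map_zero]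
    | succ q =>
      obtain ⟨b, hb, hb'⟩ := h
      exact ⟨F.f m q b, by rw [← F.map_δ, hb, F.map_d], ih hb'⟩

/-- The equation `m = k + 1` and the transport give the hypothesis the form used by the descent
lemma, where simplicial degree 0 carries no condition. -/
lemma d_δ_eq_zero {m q : ℕ} {a : A.A m q} (ha : A.d m q a = 0) (k : ℕ) (h : m = k + 1) :
    A.d k q (A.δ k q (h ▸ a)) = 0 := by
  subst h
  rw [A.d_δ, ha, map_zero]

/-- Descent can be tested after applying a quasi-isomorphism, modulo coboundaries and the image of `δ`. -/
lemma Hom.IsQuasiIso.descends {F : Hom A B} (hF : F.IsQuasiIso) {m q : ℕ} {a : A.A m q}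
    (ha : ∀ k (h : m = k + 1), A.d k q (A.δ k q (h ▸ a)) = 0) {b β : B.A m q} {γ : B.A (m + 1) q}
    (hβ : β ∈ B.cob m q) (hb : B.Descends m q b) (hab : F.f m q a = b + β + B.δ m q γ) :
    A.Descends m q a := by
  -- Only `δ a` is assumed closed, because the later elements of a staircase are not closed in
  -- general. The summand `δ γ` is allowed because such a term arises at every step.
  induction m generalizing q with
  | zero => trivial
  | succ m ih =>
    have had : A.d m q (A.δ m q a) = 0 := ha m rfl
    have h1 : F.f m q (A.δ m q a) = B.δ m q b + B.δ m q β := by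
      rw [F.map_δ, hab, map_add, map_add, B.δ_δ, add_zero]
    cases q with
    | zero =>
      obtain rfl : β = 0 := hβ
      rw [show B.δ m 0 b = 0 from hb, map_zero, add_zero] at h1
      exact hF.inj m 0 _ had h1
    | succ q =>
      obtain ⟨η, hη, hη'⟩ := hb
      obtain ⟨β, rfl⟩ := hβ
      rw [hη, ← B.d_δ, ← map_add] at h1
      obtain ⟨α, hα⟩ := hF.inj m (q + 1) _ had ⟨_, h1.symm⟩
      -- The solution `α` of `d α = δ a` need not map to the given step `η`. The discrepancy is
      -- closed after removing `δ β`, so it comes from a cocycle `z` up to a coboundary. For `α - z`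
      -- the old `β` becomes the new `γ`.
      have hz : B.d m q (F.f m q α - (η + B.δ m q β)) = 0 := by
        rw [map_sub, ← F.map_d, hα, h1, sub_self]
      obtain ⟨z, hz, hz'⟩ := hF.surj m q _ hz
      refine ⟨α - z, by rw [map_sub, hz, sub_zero, hα], ih ?_ hz' hη' (γ := β) ?_⟩
      · rintro k rfl
        rw [A.d_δ, map_sub, hz, sub_zero, hα, A.δ_δ]
      · rw [map_sub]
        abel

/-- A class of `B` lifts by surjectivity on cohomology, and injectivity makes the lift a second-page
cocycle. The staircase found in `A` is then mapped forward. -/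
lemma Hom.IsQuasiIso.permanent {F : Hom A B} (hF : F.IsQuasiIso) (hA : A.Permanent) :
    B.Permanent := by
  intro m q b hb
  obtain ⟨a, ha, hab⟩ := hF.surj m q b hb.d_eq_zero
  have ha2 : A.IsSecond m q a := by
    cases m with
    | zero => exact ha
    | succ m =>
      refine ⟨ha, hF.inj m q _ (by rw [A.d_δ, ha, map_zero]) ?_⟩
      have h := sub_mem hb.2 (δ_mem_cob hab)
      rwa [map_sub, sub_sub_cancel, ← F.map_δ] at h
  obtain ⟨c, hc, e, he, h⟩ := hA m q a ha2
  refine ⟨F.f (m + 1) q c, by rw [← F.map_d, hc, map_zero],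
    F.f m q e - (b - F.f m q a), sub_mem (F.map_mem_cob he) hab, ?_⟩
  have h' := F.descends h
  rw [map_add, map_add, F.map_δ] at h'
  convert h' using 1
  abel

/-- Here the staircase has to be pulled back. Only `c` is lifted; the coboundary `β` and the error
in lifting `c` are absorbed by the slack in the descent lemma, so no coboundary is needed in `A`. -/
lemma Hom.IsQuasiIso.permanent_of_target {F : Hom A B} (hF : F.IsQuasiIso) (hB : B.Permanent) :
    A.Permanent := by
  intro m q a ha
  obtain ⟨c, hc, β, hβ, h⟩ := hB m q _ (F.isSecond ha)
  obtain ⟨c', hc', hcc⟩ := hF.surj (m + 1) q c hc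
  refine ⟨c', hc', 0, zero_mem _, hF.descends ?_ (add_mem (neg_mem hβ) (neg_mem (δ_mem_cob hcc)))
    h (γ := 0) ?_⟩
  · exact d_δ_eq_zero (by rw [add_zero, map_add, ha.d_eq_zero, A.d_δ, hc', map_zero, add_zero])
  · simp only [map_add, map_zero, map_sub, F.map_δ]
    abel

lemma Hom.IsQuasiIso.permanent_iff {F : Hom A B} (hF : F.IsQuasiIso) :
    A.Permanent ↔ B.Permanent :=
  ⟨hF.permanent, hF.permanent_of_target⟩

/-- Without nonzero coboundaries a second-page cocycle satisfies `δ a = 0`, and its staircase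
continues by zeros. -/
lemma permanent_of_d_eq_zero (h : ∀ m q a, A.d m q a = 0) : A.Permanent := by
  have hcob : ∀ m q, A.cob m q = ⊥ := by
    intro m q
    cases q with
    | zero => rfl
    | succ q =>
      refine (AddSubgroup.eq_bot_iff_forall _).2 ?_
      rintro _ ⟨b, rfl⟩
      exact h _ _ _
  have hzero : ∀ m q, A.Descends m q 0 := by
    intro m
    induction m with
    | zero => intros; trivial
    | succ m ih =>
      intro q
      cases q with
      | zero => exact map_zero _
      | succ q => exact ⟨0, by simp, ih q⟩
  intro m q a ha
  refine ⟨0, map_zero _, 0, zero_mem _, ?_⟩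
  rw [map_zero, add_zero, add_zero]
  cases m with
  | zero => trivial
  | succ m =>
    have h0 : A.δ m q a = 0 := by
      have := ha.2
      rwa [hcob] at this
    cases q with
    | zero => exact h0
    | succ q => exact ⟨0, by rw [h0, map_zero], hzero m q⟩

end SimplicialCochain

/-! ### The Poincaré lemma for polynomial forms on a simplex -/

namespace PolyForms

variable {K : Type v} [Field K] {n : ℕ}

/-- Contraction of exterior forms with the `j`-th coordinate vector field. -/
noncomputable def interior (j : Fin n) :
    ExteriorAlgebra K (Fin n → K) →ₗ[K] ExteriorAlgebra K (Fin n → K) :=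
  CliffordAlgebra.contractLeft (Q := (0 : QuadraticForm K (Fin n → K))) (LinearMap.proj j)

lemma interior_ι_mul (j : Fin n) (v : Fin n → K) (w : ExteriorAlgebra K (Fin n → K)) :
    interior j (ExteriorAlgebra.ι K v * w) = v j • w - ExteriorAlgebra.ι K v * interior j w :=
  CliffordAlgebra.contractLeft_ι_mul _ v w

lemma interior_algebraMap (j : Fin n) (r : K) :
    interior j (algebraMap K (ExteriorAlgebra K (Fin n → K)) r) = 0 :=
  CliffordAlgebra.contractLeft_algebraMap (Q := (0 : QuadraticForm K (Fin n → K))) _ r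

lemma ι_mul_mem {p : ℕ} (v : Fin n → K) {w : ExteriorAlgebra K (Fin n → K)}
    (hw : w ∈ ⋀[K]^p (Fin n → K)) : ExteriorAlgebra.ι K v * w ∈ ⋀[K]^(p + 1) (Fin n → K) := by
  change _ ∈ LinearMap.range (ExteriorAlgebra.ι K) ^ (p + 1)
  rw [pow_succ']
  exact Submodule.mul_mem_mul (LinearMap.mem_range_self _ _) hw

/-- The degree stays a variable so that induction on membership in a power applies; the two clauses
separate degree 0 from positive degrees. -/
lemma interior_mem (j : Fin n) {p : ℕ} {w : ExteriorAlgebra K (Fin n → K)}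
    (hw : w ∈ ⋀[K]^p (Fin n → K)) :
    (p = 0 → interior j w = 0) ∧ ∀ q, p = q + 1 → interior j w ∈ ⋀[K]^q (Fin n → K) := by
  induction hw using Submodule.pow_induction_on_left' with
  | algebraMap r => exact ⟨fun _ => interior_algebraMap j r, fun q h => by omega⟩
  | add x y i hx hy ihx ihy =>
    refine ⟨fun h => ?_, fun q h => ?_⟩
    · rw [map_add, ihx.1 h, ihy.1 h, add_zero]
    · rw [map_add]
      exact add_mem (ihx.2 q h) (ihy.2 q h)
  | mem_mul m hm i x hx ih =>
    obtain ⟨v, rfl⟩ := hm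
    refine ⟨fun h => by omega, fun q h => ?_⟩
    obtain rfl : i = q := by omega
    rw [interior_ι_mul]
    refine sub_mem (Submodule.smul_mem _ _ hx) ?_
    cases i with
    | zero =>
      rw [ih.1 rfl, mul_zero]
      exact zero_mem _
    | succ i => exact ι_mul_mem v (ih.2 i rfl)

/-- This is the number operator of the exterior algebra: anticommuting `dt j` past a new factor `v`
reproduces `v` once and leaves the operator on the rest. -/
lemma sum_dt_mul_interior {p : ℕ} {w : ExteriorAlgebra K (Fin n → K)}
    (hw : w ∈ ⋀[K]^p (Fin n → K)) : ∑ j, dt j * interior j w = (p : K) • w := by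
  induction hw using Submodule.pow_induction_on_left' with
  | algebraMap r => simp [interior_algebraMap]
  | add x y i hx hy ihx ihy => simp only [map_add, mul_add, Finset.sum_add_distrib, ihx, ihy, smul_add]
  | mem_mul m hm i x hx ih =>
    obtain ⟨v, rfl⟩ := hm
    have h1 : ∀ j, dt j * interior j (ExteriorAlgebra.ι K v * x) =
        (v j • dt j) * x + ExteriorAlgebra.ι K v * (dt j * interior j x) := by
      intro j
      have h := eq_neg_of_add_eq_zero_left
        (ExteriorAlgebra.ι_add_mul_swap (R := K) (Pi.single j 1) v)
      rw [interior_ι_mul, mul_sub, mul_smul_comm, smul_mul_assoc, ← mul_assoc, h, ← mul_assoc,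
        neg_mul, sub_neg_eq_add]
    have h2 : ∑ j, v j • (dt j : ExteriorAlgebra K (Fin n → K)) = ExteriorAlgebra.ι K v := by
      simp only [← map_smul, ← map_sum]
      congr 1
      ext i
      simp [Finset.sum_apply, Pi.single_apply]
    simp only [h1, Finset.sum_add_distrib, ← Finset.sum_mul, ← Finset.mul_sum, h2, ih]
    rw [mul_smul_comm, Nat.cast_succ, add_smul, one_smul, add_comm]

/-- Contraction of forms with the Euler vector field `∑ⱼ tⱼ ∂/∂tⱼ`. -/
noncomputable def contract (n : ℕ) : Form K n →ₗ[K] Form K n :=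
  ∑ j : Fin n, TensorProduct.map (LinearMap.mulLeft K (MvPolynomial.X j)) (interior j)

lemma contract_tmul (f : MvPolynomial (Fin n) K) (w : ExteriorAlgebra K (Fin n → K)) :
    contract n (f ⊗ₜ w) = ∑ j, (MvPolynomial.X j * f) ⊗ₜ interior j w := by
  simp [contract, LinearMap.sum_apply]

lemma contract_mem {p : ℕ} {x : Form K n} (hx : x ∈ degree K n (p + 1)) :
    contract n x ∈ degree K n p := by
  induction hx using degree_induction with
  | h0 => simp
  | hadd x y _ _ hx hy => rw [map_add]; exact add_mem hx hy
  | ht f w hw =>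
    rw [contract_tmul]
    exact sum_mem fun j _ => tmul_mem_degree _ ((interior_mem j hw).2 p rfl)

/-- Cartan's formula for the Lie derivative along the Euler vector field. -/
lemma d_contract_add {p : ℕ} (f : MvPolynomial (Fin n) K) {w : ExteriorAlgebra K (Fin n → K)}
    (hw : w ∈ ⋀[K]^p (Fin n → K)) :
    d K n (contract n (f ⊗ₜ w)) + contract n (d K n (f ⊗ₜ w)) =
      (∑ j, MvPolynomial.X j * MvPolynomial.pderiv j f + (p : K) • f) ⊗ₜ w := by
  -- By the antiderivation rule the terms with `X j * pderiv k f` and `dt k * interior j w` cancel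
  -- for all `j` and `k`; only diagonal contributions survive.
  have h1 : ∀ j k : Fin n, MvPolynomial.pderiv k (MvPolynomial.X j * f) ⊗ₜ[K] (dt k * interior j w) +
      (MvPolynomial.X j * MvPolynomial.pderiv k f) ⊗ₜ[K] interior j (dt k * w) =
      if k = j then f ⊗ₜ[K] (dt j * interior j w) +
        (MvPolynomial.X j * MvPolynomial.pderiv j f) ⊗ₜ[K] w else 0 := by
    intro j k
    rw [interior_ι_mul, Derivation.leibniz, MvPolynomial.pderiv_X, TensorProduct.tmul_sub,
      TensorProduct.add_tmul, smul_eq_mul, smul_eq_mul]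
    split_ifs with h
    · subst h
      simp
      abel
    · simp [Ne.symm h]
  simp only [contract_tmul, d_tmul, map_sum]
  rw [Finset.sum_comm (f := fun x i => (MvPolynomial.X i * MvPolynomial.pderiv x f) ⊗ₜ[K] _),
    ← Finset.sum_add_distrib]
  simp only [← Finset.sum_add_distrib, h1, Finset.sum_ite_eq', Finset.mem_univ, if_true]
  rw [Finset.sum_add_distrib, ← TensorProduct.tmul_sum, sum_dt_mul_interior hw,
    ← TensorProduct.sum_tmul, TensorProduct.add_tmul, TensorProduct.tmul_smul,
    TensorProduct.smul_tmul', add_comm]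

/-- Division of the monomials of degree `k` by `k + p`. -/
noncomputable def scale (p : ℕ) : MvPolynomial (Fin n) K →ₗ[K] MvPolynomial (Fin n) K :=
  (MvPolynomial.basisMonomials (Fin n) K).constr K
    fun s => MvPolynomial.monomial s ((s.degree + p : K)⁻¹)

lemma scale_monomial (p : ℕ) (s : Fin n →₀ ℕ) (a : K) :
    scale p (MvPolynomial.monomial s a) = MvPolynomial.monomial s (a * (s.degree + p : K)⁻¹) := by
  have h : MvPolynomial.monomial s a = a • MvPolynomial.basisMonomials (Fin n) K s := by
    simp [MvPolynomial.smul_monomial]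
  rw [h, map_smul, scale, Module.Basis.constr_basis, MvPolynomial.smul_monomial, smul_eq_mul]

/-- A derivative lowers the polynomial degree by one and the shift to `p + 1` makes up for it, so
the divisor is the same on both sides. -/
lemma pderiv_scale [CharZero K] (p : ℕ) (j : Fin n) (f : MvPolynomial (Fin n) K) :
    MvPolynomial.pderiv j (scale p f) = scale (p + 1) (MvPolynomial.pderiv j f) := by
  induction f using MvPolynomial.induction_on' with
  | monomial s a =>
    rw [scale_monomial, MvPolynomial.pderiv_monomial, MvPolynomial.pderiv_monomial, scale_monomial]
    rcases Nat.eq_zero_or_pos (s j) with h | h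
    · simp [h]
    · have h1 : s.degree = (s - Finsupp.single j 1).degree + 1 := by
        conv_lhs => rw [← tsub_add_cancel_of_le (Finsupp.single_le_iff.2 h : Finsupp.single j 1 ≤ s)]
        rw [map_add, Finsupp.degree_single]
      rw [h1]
      push_cast
      congr 1
      ring
  | add f g hf hg => simp only [map_add, hf, hg]

lemma sum_X_mul_pderiv_monomial (s : Fin n →₀ ℕ) (a : K) :
    ∑ j, MvPolynomial.X j * MvPolynomial.pderiv j (MvPolynomial.monomial s a) =
      MvPolynomial.monomial s ((s.degree : K) * a) := by
  rw [(MvPolynomial.isHomogeneous_monomial a rfl).sum_X_mul_pderiv, ← map_nsmul, nsmul_eq_mul]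

/-- The Euler operator multiplies a monomial by its degree, so the sum multiplies it by exactly the
divisor, which is nonzero in characteristic 0. -/
lemma scale_euler [CharZero K] (p : ℕ) (f : MvPolynomial (Fin n) K) :
    scale (p + 1) (∑ j, MvPolynomial.X j * MvPolynomial.pderiv j f + ((p + 1 : ℕ) : K) • f) = f := by
  induction f using MvPolynomial.induction_on' with
  | monomial s a =>
    rw [sum_X_mul_pderiv_monomial, MvPolynomial.smul_monomial, smul_eq_mul, ← map_add, scale_monomial]
    have : (s.degree + (p + 1 : ℕ) : K) ≠ 0 := by 
      exact_mod_cast Nat.succ_ne_zero (s.degree + p)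
    congr 1
    field_simp
  | add f g hf hg =>
    conv_rhs => rw [← hf, ← hg]
    simp only [map_add, mul_add, Finset.sum_add_distrib, smul_add]
    abel

/-- The Euler operator kills constants, and there the divisor is 0; this is why the constant term is
lost. -/
lemma scale_zero_euler [CharZero K] (f : MvPolynomial (Fin n) K) :
    scale 0 (∑ j, MvPolynomial.X j * MvPolynomial.pderiv j f) =
      f - MvPolynomial.C (MvPolynomial.constantCoeff f) := by
  induction f using MvPolynomial.induction_on' with
  | monomial s a =>
    rw [sum_X_mul_pderiv_monomial, scale_monomial]
    rcases eq_or_ne s 0 with rfl | h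
    · simp
    · have h0 : (s.degree : K) ≠ 0 := by
        rw [Nat.cast_ne_zero, ne_eq, Finsupp.degree_eq_zero_iff]
        exact h
      have h1 : MvPolynomial.constantCoeff (MvPolynomial.monomial s a) = 0 := by
        rw [MvPolynomial.constantCoeff_eq, MvPolynomial.coeff_monomial, if_neg h]
      rw [h1, map_zero, sub_zero]
      rw [Nat.cast_zero, add_zero, mul_comm, inv_mul_cancel_left₀ h0]
  | add f g hf hg =>
    simp only [map_add, mul_add, Finset.sum_add_distrib] at hf hg ⊢
    rw [hf, hg]
    abel

/-- The operator `scale` on the polynomial coefficients of forms. -/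
noncomputable def scaleForm (p : ℕ) : Form K n →ₗ[K] Form K n :=
  TensorProduct.map (scale p) LinearMap.id

lemma scaleForm_mem (p : ℕ) {q : ℕ} {x : Form K n} (hx : x ∈ degree K n q) :
    scaleForm p x ∈ degree K n q := by
  induction hx using degree_induction with
  | h0 => simp
  | hadd x y _ _ hx hy => rw [map_add]; exact add_mem hx hy
  | ht f w hw => exact tmul_mem_degree _ hw

lemma d_scaleForm [CharZero K] (p : ℕ) (x : Form K n) :
    d K n (scaleForm p x) = scaleForm (p + 1) (d K n x) := by
  induction x using TensorProduct.induction_on with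
  | zero => simp
  | add x y hx hy => simp only [map_add, hx, hy]
  | tmul f w => simp [scaleForm, d_tmul, pderiv_scale]

lemma scaleForm_d_contract_add [CharZero K] {p : ℕ} {x : Form K n} (hx : x ∈ degree K n (p + 1)) :
    scaleForm (p + 1) (d K n (contract n x) + contract n (d K n x)) = x := by
  induction hx using degree_induction with
  | h0 => simp
  | hadd x y _ _ hx hy =>
    conv_rhs => rw [← hx, ← hy]
    simp only [map_add]
    abel
  | ht f w hw =>
    rw [d_contract_add f hw]
    exact congrArg (· ⊗ₜ[K] w) (scale_euler p f)

/-- The Poincaré lemma: closed forms of positive degree are exact. -/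
theorem exists_d_eq [CharZero K] {p : ℕ} {x : Form K n} (hx : x ∈ degree K n (p + 1))
    (hd : d K n x = 0) : ∃ y ∈ degree K n p, d K n y = x := by
  refine ⟨scaleForm p (contract n x), scaleForm_mem p (contract_mem hx), ?_⟩
  -- Scaling commutes with `d` up to the index shift, so it turns Cartan's formula into a
  -- contracting homotopy.
  have h := scaleForm_d_contract_add hx
  rwa [hd, map_zero, add_zero, ← d_scaleForm] at h

lemma exists_eq_tmul_one {x : Form K n} (hx : x ∈ degree K n 0) :
    ∃ f : MvPolynomial (Fin n) K, x = f ⊗ₜ 1 := by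
  induction hx using degree_induction with
  | h0 => exact ⟨0, by simp⟩
  | hadd x y _ _ hx hy =>
    obtain ⟨f, rfl⟩ := hx
    obtain ⟨g, rfl⟩ := hy
    exact ⟨f + g, (TensorProduct.add_tmul _ _ _).symm⟩
  | ht f w hw =>
    obtain ⟨r, rfl⟩ := Submodule.mem_one.1 (show w ∈ (1 : Submodule K _) from hw)
    exact ⟨r • f, by rw [Algebra.algebraMap_eq_smul_one, TensorProduct.tmul_smul,
      TensorProduct.smul_tmul']⟩

/-- Closed forms of degree zero are constant. -/
theorem exists_eq_smul_one [CharZero K] {x : Form K n} (hx : x ∈ degree K n 0)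
    (hd : d K n x = 0) : ∃ c : K, x = c • 1 := by
  obtain ⟨f, rfl⟩ := exists_eq_tmul_one hx
  have h1 : (1 : ExteriorAlgebra K (Fin n → K)) ∈ ⋀[K]^0 (Fin n → K) :=
    SetLike.one_mem_graded fun i : ℕ => ⋀[K]^i (Fin n → K)
  have h := d_contract_add f h1
  have hc : contract n (f ⊗ₜ[K] (1 : ExteriorAlgebra K (Fin n → K))) = 0 := by
    rw [contract_tmul]
    exact Finset.sum_eq_zero fun j _ => by rw [(interior_mem j h1).1 rfl, TensorProduct.tmul_zero]
  -- In degree 0 the contraction vanishes, so closedness says that the Euler operator kills `f`;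
  -- dividing by degrees leaves only the constant term.
  rw [hc, hd, map_zero, map_zero, add_zero, Nat.cast_zero, zero_smul, add_zero] at h
  have h2 := congrArg (scaleForm 0) h
  rw [map_zero, scaleForm, TensorProduct.map_tmul, LinearMap.id_apply, scale_zero_euler,
    TensorProduct.sub_tmul, eq_comm, sub_eq_zero] at h2
  refine ⟨MvPolynomial.constantCoeff f, h2.trans ?_⟩
  rw [Algebra.TensorProduct.one_def, TensorProduct.smul_tmul', MvPolynomial.smul_eq_C_mul, mul_one]

end PolyForms

/-! ### The simplicial vector spaces of polynomial forms -/

namespace PolyForms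

open Opposite Simplicial

variable (K : Type v) [Field K]

/-- The simplicial vector space of polynomial forms of degree `p` on the standard simplices. -/
noncomputable def plForms (p : ℕ) : SimplicialObject (ModuleCat.{v} K) where
  obj n := ModuleCat.of K (degree K n.unop.len p)
  map θ := ModuleCat.ofHom
    ((pullback K θ.unop.toOrderHom).toLinearMap.restrict fun _ hx => pullback_mem_degree _ hx)
  map_id n := by
    refine ModuleCat.hom_ext (LinearMap.ext fun x => Subtype.ext ?_)
    exact DFunLike.congr_fun (pullback_id K) x.1
  map_comp θ ψ := by
    refine ModuleCat.hom_ext (LinearMap.ext fun x => Subtype.ext ?_)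
    exact DFunLike.congr_fun (pullback_comp K θ.unop.toOrderHom ψ.unop.toOrderHom) x.1

lemma plForms_map_apply {p : ℕ} {m n : SimplexCategoryᵒᵖ} (θ : m ⟶ n)
    (x : degree K m.unop.len p) :
    (((plForms K p).map θ).hom x : degree K n.unop.len p).1 =
      pullback K θ.unop.toOrderHom x.1 := rfl

/-- The sum of the barycentric coordinates of a set of vertices. -/
noncomputable def vertexSum {n : ℕ} (s : Finset (Fin (n + 1))) : Form K n :=
  (∑ i ∈ s, bary K n i) ⊗ₜ 1

lemma vertexSum_univ {n : ℕ} : vertexSum K (Finset.univ : Finset (Fin (n + 1))) = 1 := by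
  rw [vertexSum, sum_bary, Algebra.TensorProduct.one_def]

lemma vertexSum_empty {n : ℕ} : vertexSum K (∅ : Finset (Fin (n + 1))) = 0 := by
  simp [vertexSum]

/-- Barycentric coordinates pull back to sums over fibres, so a set of vertices pulls back to its
preimage. This reduces the homotopy identities to comparisons of sets of vertices. -/
lemma pullback_vertexSum {m n : ℕ} (θ : Fin (m + 1) → Fin (n + 1)) (s : Finset (Fin (n + 1))) :
    pullback K θ (vertexSum K s) = vertexSum K (Finset.univ.filter fun i => θ i ∈ s) := by
  rw [vertexSum, pullback_tmul, map_one, map_sum, vertexSum]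
  congr 1
  simp only [subst_bary]
  rw [Finset.sum_filter, Finset.sum_comm' (t' := Finset.univ) (s' := fun i => s.filter (θ i = ·))]
  · refine Finset.sum_congr rfl fun i _ => ?_
    rw [Finset.filter_eq]
    split_ifs <;> simp
  · intro j i
    simp [eq_comm, and_comm]

lemma vertexSum_mul_mem {n p : ℕ} (s : Finset (Fin (n + 1))) {x : Form K n}
    (hx : x ∈ degree K n p) : vertexSum K s * x ∈ degree K n p := by
  have h := mul_mem_degree (tmul_mem_degree (∑ i ∈ s, bary K n i) (w := 1)
    (SetLike.one_mem_graded fun i : ℕ => ⋀[K]^i (Fin n → K))) hx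
  rwa [zero_add] at h

/-- Pullback of forms followed by multiplication with a sum of barycentric coordinates. -/
noncomputable def mulPullback (p : ℕ) {m n : SimplexCategory} (s : Finset (Fin (m.len + 1)))
    (θ : m ⟶ n) : (plForms K p).obj (op n) ⟶ (plForms K p).obj (op m) :=
  (plForms K p).map θ.op ≫ ModuleCat.ofHom
    ((LinearMap.mulLeft K (vertexSum K s)).restrict fun _ hx => vertexSum_mul_mem K s hx)

lemma mulPullback_apply {p : ℕ} {m n : SimplexCategory} (s : Finset (Fin (m.len + 1)))
    (θ : m ⟶ n) (x : degree K n.len p) :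
    ((mulPullback K p s θ).hom x : degree K m.len p).1 =
      vertexSum K s * pullback K θ.toOrderHom x.1 := rfl

lemma map_mulPullback (p : ℕ) {l m n : SimplexCategory} (s : Finset (Fin (l.len + 1)))
    (θ : l ⟶ m) (ψ : m ⟶ n) :
    (plForms K p).map ψ.op ≫ mulPullback K p s θ = mulPullback K p s (θ ≫ ψ) := by
  rw [mulPullback, mulPullback, op_comp, Functor.map_comp]
  rfl

lemma mulPullback_map (p : ℕ) {l m n : SimplexCategory} (s : Finset (Fin (m.len + 1)))
    (θ : l ⟶ m) (ψ : m ⟶ n) :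
    mulPullback K p s ψ ≫ (plForms K p).map θ.op =
      mulPullback K p (Finset.univ.filter fun i => θ.toOrderHom i ∈ s) (θ ≫ ψ) := by
  refine ModuleCat.hom_ext (LinearMap.ext fun x => Subtype.ext ?_)
  rw [ModuleCat.hom_comp, LinearMap.comp_apply]
  erw [plForms_map_apply, mulPullback_apply, mulPullback_apply]
  rw [map_mul, pullback_vertexSum]
  congr 1
  exact (DFunLike.congr_fun (pullback_comp K ψ.toOrderHom θ.toOrderHom) x.1).symm

lemma mulPullback_univ (p : ℕ) (n : SimplexCategory) :
    mulPullback K p Finset.univ (𝟙 n) = 𝟙 _ := by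
  refine ModuleCat.hom_ext (LinearMap.ext fun x => Subtype.ext ?_)
  erw [mulPullback_apply]
  rw [vertexSum_univ, one_mul]
  exact DFunLike.congr_fun (pullback_id K) x.1

lemma mulPullback_empty (p : ℕ) {m n : SimplexCategory} (θ : m ⟶ n) :
    mulPullback K p ∅ θ = 0 := by
  refine ModuleCat.hom_ext (LinearMap.ext fun x => Subtype.ext ?_)
  erw [mulPullback_apply]
  rw [vertexSum_empty, zero_mul]
  rfl

/-- The vertices of the `n + 1`-simplex after the `i`-th one. -/
def verticesAfter {n : ℕ} (i : Fin (n + 1)) : Finset (Fin (n + 2)) :=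
  Finset.univ.filter (i.castSucc < ·)

lemma mem_verticesAfter {n : ℕ} (i : Fin (n + 1)) (k : Fin (n + 2)) :
    k ∈ verticesAfter i ↔ (i : ℕ) < k := by
  simp [verticesAfter, Fin.lt_def]

lemma δ_mem_verticesAfter {n : ℕ} (i : Fin (n + 2)) (j : Fin n.succ) (k : Fin (n + 1)) :
    (SimplexCategory.δ i).toOrderHom k ∈ verticesAfter j ↔
      (j : ℕ) < if (k : ℕ) < i then (k : ℕ) else k + 1 := by
  change i.succAbove k ∈ _ ↔ _
  rw [mem_verticesAfter, Fin.succAbove]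
  simp only [Fin.lt_def, Fin.val_castSucc]
  split_ifs <;> rfl

lemma σ_mem_verticesAfter {n : ℕ} (i : Fin (n + 2)) (j : Fin n.succ) (k : Fin (n + 3)) :
    (SimplexCategory.σ i).toOrderHom k ∈ verticesAfter j ↔
      (j : ℕ) < if (i : ℕ) < k then (k : ℕ) - 1 else k := by
  change i.predAbove k ∈ _ ↔ _
  rw [mem_verticesAfter, Fin.predAbove]
  simp only [Fin.lt_def, Fin.val_castSucc]
  split_ifs <;> rfl

lemma mulPullback_congr {p : ℕ} {m n : SimplexCategory} {s t : Finset (Fin (m.len + 1))}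
    {θ ψ : m ⟶ n} (h : θ = ψ) (hs : ∀ k, k ∈ s ↔ k ∈ t) :
    mulPullback K p s θ = mulPullback K p t ψ := by
  rw [h, Finset.ext hs]

/-- The simplicial contraction of polynomial forms given by multiplication with a coordinate of the
`1`-simplex. -/
noncomputable def plFormsHomotopy (p : ℕ) :
    SimplicialObject.Homotopy (0 : plForms K p ⟶ plForms K p) (𝟙 (plForms K p)) where
  -- On the `i`-th simplex of the prism, the coordinate of the 1-simplex is the sum of the `t_k`
  -- over the vertices `k > i`. At one end all vertices occur and the factor is 1, at the other none
  -- do and it is 0. The remaining identities combine a relation in the simplex category with a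
  -- comparison of vertex sets.
  h {n} i := mulPullback K p (m := ⦋n + 1⦌) (verticesAfter i) (SimplexCategory.σ i)
  h_zero_comp_δ_zero n := by
    rw [SimplicialObject.δ_def, mulPullback_map]
    refine (mulPullback_congr K (t := Finset.univ) SimplexCategory.δ_comp_σ_self fun k => ?_).trans
      (mulPullback_univ K p ⦋n⦌)
    simp [δ_mem_verticesAfter]
  h_last_comp_δ_last n := by
    rw [SimplicialObject.δ_def, mulPullback_map]
    refine (mulPullback_congr K (t := ∅) rfl fun k => ?_).trans (mulPullback_empty K p _)
    simp only [Finset.mem_filter, Finset.mem_univ, true_and, δ_mem_verticesAfter,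
      Finset.notMem_empty, iff_false, Fin.val_last]
    have := k.2
    simp only [SimplexCategory.len_mk] at this
    split_ifs
    omega
  h_succ_comp_δ_castSucc_of_lt i j hij := by
    rw [SimplicialObject.δ_def, SimplicialObject.δ_def, mulPullback_map, map_mulPullback]
    refine mulPullback_congr K (SimplexCategory.δ_comp_σ_of_le hij) fun k => ?_
    simp only [Finset.mem_filter, Finset.mem_univ, true_and, δ_mem_verticesAfter]
    rw [mem_verticesAfter]
    simp only [Fin.le_def, Fin.val_castSucc, Fin.val_succ] at *
    split_ifs <;> omega
  h_succ_comp_δ_castSucc_succ j := by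
    rw [SimplicialObject.δ_def, mulPullback_map, mulPullback_map]
    refine mulPullback_congr K ?_ fun k => ?_
    · exact (SimplexCategory.δ_comp_σ_self' (Fin.succ_castSucc j)).trans
        SimplexCategory.δ_comp_σ_succ.symm
    · simp only [Finset.mem_filter, Finset.mem_univ, true_and, δ_mem_verticesAfter]
      simp only [Fin.val_castSucc, Fin.val_succ] at *
      split_ifs <;> omega
  h_castSucc_comp_δ_succ_of_lt i j hij := by
    rw [SimplicialObject.δ_def, SimplicialObject.δ_def, mulPullback_map, map_mulPullback]
    refine mulPullback_congr K (SimplexCategory.δ_comp_σ_of_gt hij) fun k => ?_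
    simp only [Finset.mem_filter, Finset.mem_univ, true_and, δ_mem_verticesAfter]
    rw [mem_verticesAfter]
    simp only [Fin.lt_def, Fin.val_castSucc, Fin.val_succ] at *
    split_ifs <;> omega
  h_comp_σ_castSucc_of_le i j hij := by
    rw [SimplicialObject.σ_def, SimplicialObject.σ_def, mulPullback_map, map_mulPullback]
    refine mulPullback_congr K (SimplexCategory.σ_comp_σ hij) fun k => ?_
    simp only [Finset.mem_filter, Finset.mem_univ, true_and, σ_mem_verticesAfter]
    rw [mem_verticesAfter]
    simp only [Fin.le_def, Fin.val_castSucc, Fin.val_succ] at *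
    split_ifs <;> omega
  h_comp_σ_succ_of_lt i j hij := by
    rw [SimplicialObject.σ_def, SimplicialObject.σ_def, mulPullback_map, map_mulPullback]
    refine mulPullback_congr K (SimplexCategory.σ_comp_σ hij).symm fun k => ?_
    simp only [Finset.mem_filter, Finset.mem_univ, true_and, σ_mem_verticesAfter]
    rw [mem_verticesAfter]
    simp only [Fin.le_def, Fin.val_castSucc, Fin.val_succ] at *
    split_ifs <;> omega

end PolyForms

/-! ### Injectivity -/

section Injective

open AlgebraicTopology Limits

/-- A contractible chain complex of vector spaces is injective. -/
lemma injective_of_homotopy_zero {K : Type v} [Field K] {A : ChainComplex (ModuleCat.{v} K) ℕ}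
    (h : Homotopy 0 (𝟙 A)) : Injective A := by
  refine ⟨fun {M N} g f _ => ?_⟩
  have hr : ∀ n, ∃ r : N.X n ⟶ M.X n, f.f n ≫ r = 𝟙 _ := by
    intro n
    have hm : Mono (f.f n) := inferInstance
    obtain ⟨r, hr⟩ := LinearMap.exists_leftInverse_of_injective (f.f n).hom
      (LinearMap.ker_eq_bot.2 ((ModuleCat.mono_iff_injective _).1 hm))
    exact ⟨ModuleCat.ofHom r, ModuleCat.hom_ext hr⟩
  choose r hr using hr
  have hA : Homotopy.nullHomotopicMap h.symm.hom = 𝟙 A := by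
    refine HomologicalComplex.hom_ext _ _ fun n => ?_
    have := h.symm.comm n
    rw [HomologicalComplex.zero_f, add_zero] at this
    exact this.symm
  -- The retractions `r` do not commute with differentials, but the null-homotopic map built from
  -- `r`, `g` and the contraction is a chain map. Precomposition with `f` cancels `r` and leaves `g`
  -- followed by the identity.
  refine ⟨Homotopy.nullHomotopicMap fun i j => r i ≫ g.f i ≫ h.symm.hom i j, ?_⟩
  rw [Homotopy.comp_nullHomotopicMap]
  have : (fun i j => f.f i ≫ r i ≫ g.f i ≫ h.symm.hom i j) =
      fun i j => g.f i ≫ h.symm.hom i j := by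
    funext i j
    rw [← Category.assoc, hr, Category.id_comp]
  rw [this, ← Homotopy.comp_nullHomotopicMap, hA, Category.comp_id]

/-- By Dold–Kan it is enough that the normalized complex be contractible. The contraction of the
alternating face map complex is transported along the homotopy equivalence with the normalized one.
-/
lemma injective_of_simplicialHomotopy {K : Type v} [Field K] {A : SimplicialObject (ModuleCat.{v} K)}
    (h : SimplicialObject.Homotopy 0 (𝟙 A)) : Injective A := by
  rw [← (Abelian.DoldKan.equivalence (A := ModuleCat.{v} K)).map_injective_iff]
  let e := DoldKan.homotopyEquivNormalizedMooreComplexAlternatingFaceMapComplex (Y := A)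
  refine injective_of_homotopy_zero (A := (normalizedMooreComplex _).obj A) ?_
  refine (Homotopy.ofEq ?_).trans
    (((h.toChainHomotopy.compLeft e.hom).compRight e.inv).trans ((Homotopy.ofEq ?_).trans
      e.homotopyHomInvId))
  · rw [Functor.map_zero, Limits.comp_zero, Limits.zero_comp]
  · rw [CategoryTheory.Functor.map_id, Category.comp_id]

/-- Evaluation functors preserve homology, and a functor is zero when all its values are. -/
lemma shortComplex_exact_of_evaluation {J : Type*} [Category* J] {C : Type*} [Category* C] [Abelian C]
    (S : ShortComplex (J ⥤ C)) (h : ∀ j, (S.map ((evaluation J C).obj j)).Exact) : S.Exact := by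
  rw [ShortComplex.exact_iff_isZero_homology, Functor.isZero_iff]
  intro j
  exact ((ShortComplex.exact_iff_isZero_homology _).1 (h j)).of_iso
    (S.mapHomologyIso ((evaluation J C).obj j)).symm

/-- A resolution by injective objects, from exactness in each degree. -/
noncomputable def injectiveResolutionOfExact {C : Type*} [Category* C] [Abelian C] (Z : C)
    (A : CochainComplex C ℕ) (hA : ∀ n, Injective (A.X n)) (z : Z ⟶ A.X 0) (hm : Mono z)
    (hz : z ≫ A.d 0 1 = 0) (h0 : (ShortComplex.mk z (A.d 0 1) hz).Exact)
    (h : ∀ n, (ShortComplex.mk _ _ (A.d_comp_d n (n + 1) (n + 2))).Exact) :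
    InjectiveResolution Z where
  cocomplex := A
  injective := hA
  ι := (CochainComplex.fromSingle₀Equiv _ _).symm ⟨z, hz⟩
  quasiIso := ⟨fun n => by
    rcases n with _ | n
    · rw [CochainComplex.quasiIsoAt₀_iff, ShortComplex.quasiIso_iff_of_zeros]
      · refine (ShortComplex.exact_and_mono_f_iff_of_iso ?_).2 ⟨h0, hm⟩
        exact ShortComplex.isoMk (Iso.refl _) (Iso.refl _) (Iso.refl _)
          (((Category.id_comp _).trans
            (CochainComplex.fromSingle₀Equiv_symm_apply_f_zero (C := A) z hz).symm).trans
              (Category.comp_id _).symm)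
          ((Category.id_comp _).trans (Category.comp_id _).symm)
      all_goals first | rfl | exact A.shape _ _ (by simp)
    · rw [quasiIsoAt_iff_exactAt]
      · rw [A.exactAt_iff' n (n + 1) (n + 2) (by simp) (by simp)]
        exact h _
      · apply CochainComplex.exactAt_succ_single_obj⟩

end Injective

namespace PolyForms

open Opposite Simplicial AlgebraicTopology Limits

variable (K : Type v) [Field K]

/-! ### Cochains on the standard simplices -/

/-- The simplicial vector spaces of `q`-cochains on the standard simplices, as a cosimplicial object in
the variable `q`. -/
def simplexCochains : CosimplicialObject (SimplicialObject (ModuleCat.{v} K)) where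
  obj q :=
    { obj n := ModuleCat.of K ((q ⟶ n.unop) → K)
      map θ := ModuleCat.ofHom (LinearMap.funLeft K K fun τ => τ ≫ θ.unop) }
  map φ := { app n := ModuleCat.ofHom (LinearMap.funLeft K K fun τ => φ ≫ τ) }

/-- The cochain complex of simplicial vector spaces given by cochains on the standard simplices. -/
noncomputable def cochainComplex : CochainComplex (SimplicialObject (ModuleCat.{v} K)) ℕ :=
  (alternatingCofaceMapComplex _).obj (simplexCochains K)

/-- The de Rham differential as a map of simplicial vector spaces. -/
noncomputable def plFormsD (p : ℕ) : plForms K p ⟶ plForms K (p + 1) where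
  app n := ModuleCat.ofHom ((d K n.unop.len).restrict fun _ hx => d_mem_degree hx)
  naturality m n θ := by
    refine ModuleCat.hom_ext (LinearMap.ext fun x => Subtype.ext ?_)
    exact d_pullback K _ _

/-- The cochain complex of simplicial vector spaces given by forms on the standard simplices. -/
noncomputable def plComplex : CochainComplex (SimplicialObject (ModuleCat.{v} K)) ℕ :=
  CochainComplex.of (plForms K) (plFormsD K) fun _ =>
    NatTrans.ext (funext fun _ => ModuleCat.hom_ext (LinearMap.ext fun _ => Subtype.ext (d_d K _)))

/-- The constant simplicial vector space. -/
def constants : SimplicialObject (ModuleCat.{v} K) := (Functor.const _).obj (ModuleCat.of K K)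

/-- These objects are cofree: a map from `N` into one is the same as a linear functional on `N` in
degree `q`, evaluated at `𝟙 q`. Extending a map therefore needs only a linear retraction in that
degree. -/
lemma injective_simplexCochains (q : SimplexCategory) : Injective ((simplexCochains K).obj q) := by
  refine ⟨fun {M N} g f _ => ?_⟩
  have hm : Mono (f.app (op q)) := inferInstance
  obtain ⟨r, hr⟩ := LinearMap.exists_leftInverse_of_injective (f.app (op q)).hom
    (LinearMap.ker_eq_bot.2 ((ModuleCat.mono_iff_injective _).1 hm))
  refine ⟨{ app n := ModuleCat.ofHom (LinearMap.pi fun τ : q ⟶ n.unop =>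
      (LinearMap.proj (𝟙 q)).comp ((g.app (op q)).hom.comp (r.comp (N.map τ.op).hom)))
            naturality m n θ := ?_ }, ?_⟩
  · refine ModuleCat.hom_ext (LinearMap.ext fun x => funext fun τ => ?_)
    change (g.app (op q)).hom (r ((N.map τ.op).hom ((N.map θ).hom x))) (𝟙 q) =
      (g.app (op q)).hom (r ((N.map (τ ≫ θ.unop).op).hom x)) (𝟙 q)
    rw [op_comp, Functor.map_comp]
    rfl
  · refine NatTrans.ext (funext fun n => ModuleCat.hom_ext (LinearMap.ext fun x => funext fun τ => ?_))
    change (g.app (op q)).hom (r ((N.map τ.op).hom ((f.app n).hom x))) (𝟙 q) =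
      (g.app n).hom x τ
    have h1 : (N.map τ.op).hom ((f.app n).hom x) = (f.app (op q)).hom ((M.map τ.op).hom x) :=
      congrArg (fun e => e.hom x) (f.naturality τ.op).symm
    have h2 : (g.app (op q)).hom ((M.map τ.op).hom x) = fun ρ => (g.app n).hom x (ρ ≫ τ) :=
      congrArg (fun e => e.hom x) (g.naturality τ.op)
    have h3 : r ((f.app (op q)).hom ((M.map τ.op).hom x)) = (M.map τ.op).hom x :=
      LinearMap.congr_fun hr _
    rw [h1, h3, h2]
    exact congrArg ((g.app n).hom x) (Category.id_comp τ)

lemma cochainComplex_d_apply (q : ℕ) (n : SimplexCategoryᵒᵖ) (c : (⦋q⦌ ⟶ n.unop) → K)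
    (τ : ⦋q + 1⦌ ⟶ n.unop) :
    (((cochainComplex K).d q (q + 1)).app n).hom c τ =
      ∑ i : Fin (q + 2), (-1 : ℤ) ^ (i : ℕ) • c (SimplexCategory.δ i ≫ τ) := by
  have h : (cochainComplex K).d q (q + 1) =
      ∑ i : Fin (q + 2), (-1 : ℤ) ^ (i : ℕ) • (simplexCochains K).δ i :=
    CochainComplex.of_d (fun n => (simplexCochains K).obj (.mk n))
      (AlternatingCofaceMapComplex.objD (simplexCochains K)) q
  let ev : (((simplexCochains K).obj ⦋q⦌ : SimplicialObject (ModuleCat.{v} K)) ⟶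
      (simplexCochains K).obj ⦋q + 1⦌) →+ K :=
    { toFun f := (f.app n).hom c τ
      map_zero' := rfl
      map_add' _ _ := rfl }
  refine (congrArg ev h).trans ?_
  rw [map_sum]
  refine Finset.sum_congr rfl fun i _ => ?_
  rw [map_zsmul]
  rfl

/-- The cone on a simplex of the standard simplex, with apex the initial vertex. -/
def cone {q : ℕ} {n : SimplexCategory} (τ : ⦋q⦌ ⟶ n) : ⦋q + 1⦌ ⟶ n :=
  SimplexCategory.mkHom (m := n.len)
    { toFun := Fin.cons 0 τ.toOrderHom
      monotone' := by
        intro i j hij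
        refine Fin.cases (fun _ => ?_) (fun i hij => ?_) i hij
        · exact Fin.zero_le _
        · obtain ⟨j, rfl⟩ := Fin.exists_succ_eq.2 (Fin.pos_iff_ne_zero.1 (i.succ_pos.trans_le hij))
          exact τ.toOrderHom.monotone (Fin.succ_le_succ_iff.1 hij) }

lemma δ_zero_cone {q : ℕ} {n : SimplexCategory} (τ : ⦋q⦌ ⟶ n) :
    SimplexCategory.δ 0 ≫ cone τ = τ := by
  refine SimplexCategory.Hom.ext _ _ (OrderHom.ext _ _ (funext fun k => ?_))
  rfl

lemma δ_succ_cone {q : ℕ} {n : SimplexCategory} (τ : ⦋q + 1⦌ ⟶ n) (i : Fin (q + 2)) :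
    SimplexCategory.δ i.succ ≫ cone τ = cone (SimplexCategory.δ i ≫ τ) := by
  refine SimplexCategory.Hom.ext _ _ (OrderHom.ext _ _ (funext fun k => ?_))
  refine Fin.cases ?_ (fun k => ?_) k
  · change Fin.cons (α := fun _ => Fin (n.len + 1)) 0 τ.toOrderHom (i.succ.succAbove 0) = 0
    rw [Fin.succ_succAbove_zero]
    rfl
  · change Fin.cons (α := fun _ => Fin (n.len + 1)) 0 τ.toOrderHom (i.succ.succAbove k.succ) = _
    rw [Fin.succ_succAbove_succ]
    rfl

/-- The cone operator is a contracting homotopy: face 0 of a cone is the simplex itself, and the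
other faces are cones on its faces. Degenerate simplices are admitted, so every simplex has a cone.
-/
lemma exists_cochain_d_eq {q : ℕ} {n : SimplexCategoryᵒᵖ} {c : (⦋q + 1⦌ ⟶ n.unop) → K}
    (hc : (((cochainComplex K).d (q + 1) (q + 2)).app n).hom c = 0) :
    (((cochainComplex K).d q (q + 1)).app n).hom (fun τ => c (cone τ)) = c := by
  funext τ
  have h := congrFun hc (cone τ)
  rw [cochainComplex_d_apply, Fin.sum_univ_succ] at h
  rw [cochainComplex_d_apply]
  simp only [δ_zero_cone, δ_succ_cone, Fin.val_zero, pow_zero, one_smul, Fin.val_succ, pow_succ,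
    mul_neg_one, neg_smul, Finset.sum_neg_distrib] at h
  exact (eq_of_sub_eq_zero ((sub_eq_add_neg _ _).trans h)).symm

/-- A closed 0-cochain is compared at a vertex and at the initial vertex by evaluating its
differential on the edge joining them. -/
lemma eq_const_of_cochain_d_eq_zero {n : SimplexCategoryᵒᵖ} {c : (⦋0⦌ ⟶ n.unop) → K}
    (hc : (((cochainComplex K).d 0 1).app n).hom c = 0) (τ : ⦋0⦌ ⟶ n.unop) :
    c τ = c (SimplexCategory.const ⦋0⦌ n.unop 0) := by
  have h := congrFun hc (cone τ)
  rw [cochainComplex_d_apply, Fin.sum_univ_two, δ_zero_cone] at h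
  have h1 : SimplexCategory.δ 1 ≫ cone τ = SimplexCategory.const ⦋0⦌ n.unop 0 := by
    refine SimplexCategory.Hom.ext _ _ (OrderHom.ext _ _ (funext fun k => ?_))
    fin_cases k
    rfl
  rw [h1] at h
  rw [Fin.val_zero, Fin.val_one, pow_zero, pow_one, one_smul, neg_smul, one_smul] at h
  exact eq_of_sub_eq_zero ((sub_eq_add_neg _ _).trans h)

/-- The inclusion of the constants into the `0`-cochains. -/
def constantsToCochains : constants K ⟶ (simplexCochains K).obj ⦋0⦌ where
  app n := ModuleCat.ofHom (LinearMap.pi fun _ => LinearMap.id)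

lemma mono_constantsToCochains : Mono (constantsToCochains K) := by
  refine (NatTrans.mono_iff_mono_app _).2 fun n => (ModuleCat.mono_iff_injective _).2 fun x y h => ?_
  exact congrFun h (SimplexCategory.const ⦋0⦌ n.unop 0)

lemma constantsToCochains_d : constantsToCochains K ≫ (cochainComplex K).d 0 1 = 0 := by
  refine NatTrans.ext (funext fun n => ModuleCat.hom_ext (LinearMap.ext fun x => funext fun τ => ?_))
  refine (cochainComplex_d_apply K 0 n _ τ).trans ?_
  rw [Fin.sum_univ_two]
  exact (congrArg₂ (· + ·) (one_smul ℤ x) (neg_one_zsmul x)).trans (add_neg_cancel x)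

/-- Cochains on the standard simplices form an injective resolution of the constants. -/
noncomputable def cochainResolution : InjectiveResolution (constants K) :=
  injectiveResolutionOfExact (constants K) (cochainComplex K)
    (fun n => injective_simplexCochains K ⦋n⦌) (constantsToCochains K)
    (mono_constantsToCochains K) (constantsToCochains_d K)
    (shortComplex_exact_of_evaluation _ fun _ => (ShortComplex.moduleCat_exact_iff _).2
      fun _ hc => ⟨_, funext fun τ => (eq_const_of_cochain_d_eq_zero K hc τ).symm⟩)
    (fun _ => shortComplex_exact_of_evaluation _ fun _ => (ShortComplex.moduleCat_exact_iff _).2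
      fun _ hc => ⟨_, exists_cochain_d_eq K hc⟩)

lemma plComplex_d_apply (p : ℕ) (n : SimplexCategoryᵒᵖ) (x : degree K n.unop.len p) :
    ((((plComplex K).d p (p + 1)).app n).hom x : degree K n.unop.len (p + 1)).1 =
      d K n.unop.len x.1 := by
  have h : (plComplex K).d p (p + 1) = plFormsD K p := CochainComplex.of_d (plForms K) (plFormsD K) p
  rw [h]
  rfl

/-- The inclusion of the constants into the forms of degree `0`. -/
noncomputable def constantsToForms : constants K ⟶ plForms K 0 where
  app n := ModuleCat.ofHom ((LinearMap.toSpanSingleton K (degree K n.unop.len 0) ⟨1, one_mem_degree⟩))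
  naturality m n θ := by
    refine ModuleCat.hom_ext (LinearMap.ext fun (x : K) => Subtype.ext ?_)
    change x • (1 : Form K n.unop.len) = pullback K θ.unop.toOrderHom (x • 1)
    rw [map_smul, map_one]

lemma mono_constantsToForms : Mono (constantsToForms K) := by
  refine (NatTrans.mono_iff_mono_app _).2 fun n => (ModuleCat.mono_iff_injective _).2 ?_
  intro (x : K) (y : K) h
  have h1 : x • (1 : Form K n.unop.len) = y • 1 := congrArg Subtype.val h
  exact smul_left_injective K (one_ne_zero (α := Form K n.unop.len)) h1

lemma constantsToForms_d : constantsToForms K ≫ (plComplex K).d 0 1 = 0 := by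
  refine NatTrans.ext (funext fun n =>
    ModuleCat.hom_ext (LinearMap.ext fun (x : K) => Subtype.ext ?_))
  refine (plComplex_d_apply K 0 n _).trans ?_
  change d K n.unop.len (x • (1 : Form K n.unop.len)) = 0
  rw [map_smul, Algebra.TensorProduct.one_def, d_tmul]
  simp

/-- Polynomial forms on the standard simplices form an injective resolution of the constants. -/
noncomputable def plResolution [CharZero K] : InjectiveResolution (constants K) :=
  injectiveResolutionOfExact (constants K) (plComplex K)
    (fun p => injective_of_simplicialHomotopy (plFormsHomotopy K p)) (constantsToForms K)
    (mono_constantsToForms K) (constantsToForms_d K)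
    (shortComplex_exact_of_evaluation _ fun n => (ShortComplex.moduleCat_exact_iff _).2
      fun (x : degree K n.unop.len 0) hx => by
        obtain ⟨c, hc⟩ := exists_eq_smul_one x.2
          ((plComplex_d_apply K 0 n x).symm.trans (congrArg Subtype.val hx))
        exact ⟨c, Subtype.ext hc.symm⟩)
    (fun p => shortComplex_exact_of_evaluation _ fun n => (ShortComplex.moduleCat_exact_iff _).2
      fun (x : degree K n.unop.len (p + 1)) hx => by
        obtain ⟨y, hy, hyx⟩ := exists_d_eq x.2
          ((plComplex_d_apply K (p + 1) n x).symm.trans (congrArg Subtype.val hx))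
        exact ⟨⟨y, hy⟩, Subtype.ext ((plComplex_d_apply K p n ⟨y, hy⟩).trans hyx)⟩)

end PolyForms

/-! ### Simplicial cochain complexes from complexes of simplicial groups -/

namespace SimplicialCochain

open AlgebraicTopology Opposite Simplicial

/-- The simplicial cochain complex underlying a cochain complex of simplicial abelian groups. -/
noncomputable def ofComplex (G : CochainComplex (SimplicialObject AddCommGrpCat.{w}) ℕ) :
    SimplicialCochain.{w} where
  A m q := (G.X q).obj (op ⦋m⦌)
  d m q := ((G.d q (q + 1)).app (op ⦋m⦌)).hom
  δ m q := (((alternatingFaceMapComplex _).obj (G.X q)).d (m + 1) m).hom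
  d_d m q a := by
    have h := congrArg (fun f => (f.app (op ⦋m⦌)).hom a) (G.d_comp_d q (q + 1) (q + 1 + 1))
    exact h
  δ_δ m q a := by
    have h := congrArg (fun f => f.hom a)
      (((alternatingFaceMapComplex _).obj (G.X q)).d_comp_d (m + 1 + 1) (m + 1) m)
    exact h
  d_δ m q a := by
    have h := congrArg (fun f => f.hom a)
      (((alternatingFaceMapComplex _).map (G.d q (q + 1))).comm (m + 1) m)
    exact h.symm

lemma ofComplex_δ_apply (G : CochainComplex (SimplicialObject AddCommGrpCat.{w}) ℕ) (m q : ℕ)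
    (a : (G.X q).obj (op ⦋m + 1⦌)) : (ofComplex G).δ m q a =
      ∑ i : Fin (m + 2), (-1 : ℤ) ^ (i : ℕ) • ((G.X q).δ i).hom a := by
  have h : ((alternatingFaceMapComplex _).obj (G.X q)).d (m + 1) m =
      ∑ i : Fin (m + 2), (-1 : ℤ) ^ (i : ℕ) • (G.X q).δ i :=
    alternatingFaceMapComplex_obj_d (G.X q) m
  let ev : (((G.X q).obj (op ⦋m + 1⦌)) ⟶ ((G.X q).obj (op ⦋m⦌))) →+ ((G.X q).obj (op ⦋m⦌)) :=
    { toFun f := f.hom a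
      map_zero' := rfl
      map_add' _ _ := rfl }
  refine (congrArg ev h).trans ?_
  rw [map_sum]
  refine Finset.sum_congr rfl fun i _ => ?_
  rw [map_zsmul]
  rfl

variable {G G' : CochainComplex (SimplicialObject AddCommGrpCat.{w}) ℕ}

/-- The morphism of simplicial cochain complexes underlying a morphism of complexes. -/
noncomputable def Hom.ofHom (f : G ⟶ G') : Hom (ofComplex G) (ofComplex G') where
  f m q := ((f.f q).app (op ⦋m⦌)).hom
  map_d m q a := by
    have h := congrArg (fun f => (f.app (op ⦋m⦌)).hom a) (f.comm q (q + 1))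
    exact h.symm
  map_δ m q a := by
    have h := congrArg (fun f => f.hom a)
      (((alternatingFaceMapComplex _).map (f.f q)).comm (m + 1) m)
    exact h.symm

lemma Hom.sub_mem_cob_of_homotopy {f g : G ⟶ G'} (h : Homotopy f g) {m q : ℕ}
    {a : (ofComplex G).A m q} (ha : (ofComplex G).d m q a = 0) :
    (Hom.ofHom f).f m q a - (Hom.ofHom g).f m q a ∈ (ofComplex G').cob m q := by
  have hd : ((h.hom (q + 1) q).app (op ⦋m⦌)).hom (((G.d q (q + 1)).app (op ⦋m⦌)).hom a) = 0 := by
    refine (congrArg _ ha).trans (map_zero _)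
  have hq := congrArg (fun f => (f.app (op ⦋m⦌)).hom a) (h.comm q)
  rw [Homotopy.dNext_cochainComplex] at hq
  cases q with
  | zero =>
    -- In degree 0 the homotopy has no incoming term, in accordance with there being no
    -- coboundaries.
    rw [Homotopy.prevD_zero_cochainComplex, add_zero] at hq
    have h1 : (Hom.ofHom f).f m 0 a = _ + (Hom.ofHom g).f m 0 a := hq
    have h2 : (Hom.ofHom f).f m 0 a = 0 + (Hom.ofHom g).f m 0 a :=
      h1.trans (congrArg (· + (Hom.ofHom g).f m 0 a) hd)
    rw [h2, zero_add, sub_self]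
    exact zero_mem _
  | succ q =>
    rw [Homotopy.prevD_succ_cochainComplex] at hq
    have h2 : (Hom.ofHom f).f m (q + 1) a = 0 + (ofComplex G').d m q
        (((h.hom (q + 1) q).app (op ⦋m⦌)).hom a) + (Hom.ofHom g).f m (q + 1) a :=
      hq.trans (congrArg (fun z => z + (ofComplex G').d m q
        (((h.hom (q + 1) q).app (op ⦋m⦌)).hom a) + (Hom.ofHom g).f m (q + 1) a) hd)
    rw [h2, zero_add, add_sub_cancel_right]
    exact ⟨_, rfl⟩

lemma Hom.isQuasiIso_of_homotopyEquiv (e : HomotopyEquiv G G') : (Hom.ofHom e.hom).IsQuasiIso where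
  inj m q a ha h := by
    have h1 := sub_mem_cob_of_homotopy e.homotopyHomInvId ha
    have h2 : (Hom.ofHom e.inv).f m q ((Hom.ofHom e.hom).f m q a) - a ∈ (ofComplex G).cob m q := h1
    have h3 := sub_mem ((Hom.ofHom e.inv).map_mem_cob h) h2
    rwa [sub_sub_cancel] at h3
  surj m q b hb := by
    refine ⟨(Hom.ofHom e.inv).f m q b, by rw [← Hom.map_d, hb, map_zero], ?_⟩
    have h1 : (Hom.ofHom e.hom).f m q ((Hom.ofHom e.inv).f m q b) - b ∈ (ofComplex G').cob m q :=
      sub_mem_cob_of_homotopy e.homotopyInvHomId hb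
    rw [← neg_sub]
    exact neg_mem h1

end SimplicialCochain

/-! ### Formality and permanence -/

namespace CDGA

open Opposite Simplicial

variable {K : Type v} [Field K]

/-- The group of elements of degree `q` of a CDGA. -/
def degreeFunctor (K : Type v) [Field K] (q : ℕ) : CDGA.{v, w} K ⥤ AddCommGrpCat.{w} where
  obj A := AddCommGrpCat.of (A.A q)
  map F := AddCommGrpCat.ofHom (F.f q).toAddMonoidHom

/-- The differential as a natural transformation. -/
def differential (K : Type v) [Field K] (q : ℕ) :
    degreeFunctor.{v, w} K q ⟶ degreeFunctor K (q + 1) where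
  app A := AddCommGrpCat.ofHom (A.d q).toAddMonoidHom
  naturality _ _ F := AddCommGrpCat.hom_ext (AddMonoidHom.ext fun a => (F.map_d a).symm)

/-- The cochain complex of simplicial groups underlying a simplicial CDGA. -/
noncomputable def complex (F : SimplexCategoryᵒᵖ ⥤ CDGA.{v, w} K) :
    CochainComplex (SimplicialObject AddCommGrpCat.{w}) ℕ :=
  CochainComplex.of (fun q => F ⋙ degreeFunctor K q)
    (fun q => Functor.whiskerLeft F (differential K q))
    (fun _ => NatTrans.ext (funext fun n => AddCommGrpCat.hom_ext
      (AddMonoidHom.ext fun a => (F.obj n).d_d a)))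

/-- The simplicial cochain complex underlying a simplicial CDGA. -/
noncomputable abbrev cochains (F : SimplexCategoryᵒᵖ ⥤ CDGA.{v, w} K) : SimplicialCochain.{w} :=
  SimplicialCochain.ofComplex (complex F)

lemma complex_d (F : SimplexCategoryᵒᵖ ⥤ CDGA.{v, w} K) (q : ℕ) :
    (complex F).d q (q + 1) = Functor.whiskerLeft F (differential K q) :=
  CochainComplex.of_d (fun q => (F ⋙ degreeFunctor K q : SimplicialObject _))
    (fun q => Functor.whiskerLeft F (differential K q)) q

lemma cochains_d (F : SimplexCategoryᵒᵖ ⥤ CDGA.{v, w} K) (m q : ℕ) (a : (cochains F).A m q) :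
    (cochains F).d m q a = (F.obj (op ⦋m⦌)).d q a :=
  congrArg (fun f => (f.app (op ⦋m⦌)).hom a) (complex_d F q)

lemma mem_cob_cochains (F : SimplexCategoryᵒᵖ ⥤ CDGA.{v, w} K) (m q : ℕ)
    (a : (cochains F).A m q) :
    a ∈ (cochains F).cob m q ↔ a ∈ (F.obj (op ⦋m⦌)).coboundaries q := by
  cases q with
  | zero => exact Iff.rfl
  | succ q => exact exists_congr fun b => iff_of_eq (congrArg (· = a) (cochains_d F m q b))

/-- The morphism of simplicial cochain complexes induced by a morphism of simplicial CDGAs. -/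
noncomputable def cochainsHom {F F' : SimplexCategoryᵒᵖ ⥤ CDGA.{v, w} K} (η : F ⟶ F') :
    SimplicialCochain.Hom (cochains F) (cochains F') :=
  SimplicialCochain.Hom.ofHom
    (CochainComplex.ofHom
      (fun q => Functor.whiskerRight η (degreeFunctor K q))
      fun q => by
        rw [complex_d, complex_d]
        exact NatTrans.ext (funext fun n => AddCommGrpCat.hom_ext
          (AddMonoidHom.ext fun a => ((η.app n).map_d a).symm)))

lemma isQuasiIso_cochainsHom {F F' : SimplexCategoryᵒᵖ ⥤ CDGA.{v, w} K} (η : F ⟶ F')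
    (h : ∀ j, IsQuasiIso (η.app j)) : (cochainsHom η).IsQuasiIso where
  inj m q a ha hb := by
    replace ha := (cochains_d F m q a).symm.trans ha
    rw [mem_cob_cochains] at hb ⊢
    have h1 : mapH (η.app (op ⦋m⦌)) q (Submodule.Quotient.mk ⟨a, ha⟩) = 0 := by
      rw [mapH_mk]
      exact (Submodule.Quotient.mk_eq_zero _).2 hb
    exact (Submodule.Quotient.mk_eq_zero (F.obj (op ⦋m⦌) |>.coboundariesIn q)).1
      ((injective_iff_map_eq_zero _).1 (h (op ⦋m⦌) q).1 _ h1)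
  surj m q b hb := by
    replace hb := (cochains_d F' m q b).symm.trans hb
    obtain ⟨a, ha⟩ := (h (op ⦋m⦌) q).2 (Submodule.Quotient.mk ⟨b, hb⟩)
    obtain ⟨a, rfl⟩ := Submodule.Quotient.mk_surjective _ a
    rw [mapH_mk] at ha
    refine ⟨a.1, ?_, ?_⟩
    · exact (cochains_d F m q a.1).trans a.2
    · rw [mem_cob_cochains]
      exact (Submodule.Quotient.eq (F'.obj (op ⦋m⦌) |>.coboundariesIn q)).1 ha.symm

/-- In the simplicial cochain complex of a formal simplicial CDGA, every class on the second page is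
represented by a cocycle which descends. -/
lemma IsFormal.permanent {F : SimplexCategoryᵒᵖ ⥤ CDGA.{v, w} K} (hF : IsFormal F) :
    (cochains F).Permanent := by
  -- An equivalence between arbitrary diagrams is required, since the arrows of a zig-zag point both
  -- ways.
  have h : ∀ A B : SimplexCategoryᵒᵖ ⥤ CDGA.{v, w} K, Relation.EqvGen NatQuasiIso A B →
      ((cochains A).Permanent ↔ (cochains B).Permanent) := by
    intro A B hAB
    induction hAB with
    | rel A B h =>
      obtain ⟨η, hη⟩ := h
      exact (isQuasiIso_cochainsHom η hη).permanent_iff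
    | refl A => exact Iff.rfl
    | symm A B _ ih => exact ih.symm
    | trans A B C _ _ ih ih' => exact ih.trans ih'
  exact (h _ _ hF).2 (SimplicialCochain.permanent_of_d_eq_zero fun m q a =>
    cochains_d (F ⋙ cohomologyFunctor K) m q a)

end CDGA

namespace SimplicialCochain

lemma Hom.isQuasiIso_of_bijective {A B : SimplicialCochain.{w}} (F : Hom A B)
    (h : ∀ m q, Function.Bijective (F.f m q)) : F.IsQuasiIso where
  inj m q a _ hb := by
    cases q with
    | zero => exact (injective_iff_map_eq_zero _).1 (h m 0).1 a hb
    | succ q =>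
      obtain ⟨b, hb⟩ := hb
      obtain ⟨a', rfl⟩ := (h m q).2 b
      exact ⟨a', (h m (q + 1)).1 ((F.map_d m q a').trans hb)⟩
  surj m q b hb := by
    obtain ⟨a, rfl⟩ := (h m q).2 b
    refine ⟨a, (injective_iff_map_eq_zero _).1 (h m (q + 1)).1 _ ((F.map_d m q a).trans hb), ?_⟩
    rw [sub_self]
    exact zero_mem _

end SimplicialCochain

/-! ### Simplicial maps into simplicial vector spaces -/

namespace PolyForms

open Opposite Simplicial AlgebraicTopology

variable {K : Type v} [Field K]

/-- The simplicial maps from a simplicial set to a simplicial vector space. -/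
def sections (M : SimplicialObject (ModuleCat.{v} K)) (S : SSet.{u}) :
    AddSubgroup (∀ n : SimplexCategoryᵒᵖ, S.obj n → M.obj n) where
  carrier := {a | ∀ (m n : SimplexCategoryᵒᵖ) (θ : m ⟶ n) (σ : S.obj m),
    a n (S.map θ σ) = (M.map θ).hom (a m σ)}
  add_mem' ha hb m n θ σ := by
    rw [Pi.add_apply, Pi.add_apply, Pi.add_apply, Pi.add_apply, ha m n θ σ, hb m n θ σ, map_add]
  zero_mem' m n θ σ := (map_zero (M.map θ).hom).symm
  neg_mem' ha m n θ σ := by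
    rw [Pi.neg_apply, Pi.neg_apply, Pi.neg_apply, Pi.neg_apply, ha m n θ σ, map_neg]

/-- Simplicial maps from a cosimplicial simplicial set to simplicial vector spaces. -/
def sectionsFunctor (K : Type v) [Field K] (Y : CosimplicialObject SSet.{u}) :
    SimplicialObject (ModuleCat.{v} K) ⥤ SimplicialObject AddCommGrpCat.{max u v} where
  obj M :=
    { obj m := AddCommGrpCat.of (sections M (Y.obj m.unop))
      map θ := AddCommGrpCat.ofHom
        { toFun a := ⟨fun n σ => a.1 n ((Y.map θ.unop).app n σ), fun m n ψ σ =>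
            (congrArg (a.1 n) (NatTrans.naturality_apply (Y.map θ.unop) ψ σ)).trans (a.2 m n ψ _)⟩
          map_zero' := rfl
          map_add' _ _ := rfl }
      map_id m := AddCommGrpCat.hom_ext (AddMonoidHom.ext fun a => Subtype.ext <|
        funext fun n => funext fun σ =>
          congrArg (fun f : Y.obj m.unop ⟶ Y.obj m.unop => a.1 n (f.app n σ)) (Y.map_id m.unop))
      map_comp {m m' m''} θ ψ := AddCommGrpCat.hom_ext (AddMonoidHom.ext fun a => Subtype.ext <|
        funext fun n => funext fun σ =>
          congrArg (fun f : Y.obj m''.unop ⟶ Y.obj m.unop => a.1 n (f.app n σ))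
            (Y.map_comp ψ.unop θ.unop)) }
  map {M N} f :=
    { app m := AddCommGrpCat.ofHom
        { toFun a := ⟨fun n σ => (f.app n).hom (a.1 n σ), fun m n θ σ =>
            (congrArg (f.app n).hom (a.2 m n θ σ)).trans
              (congrArg (fun g => g.hom (a.1 m σ)) (f.naturality θ))⟩
          map_zero' := Subtype.ext (funext fun n => funext fun σ => map_zero (f.app n).hom)
          map_add' a b := Subtype.ext (funext fun n => funext fun σ => map_add (f.app n).hom _ _) } }

/-- Additivity lets the functor act on homotopy equivalences of complexes. -/
instance (Y : CosimplicialObject SSet.{u}) : (sectionsFunctor K Y).Additive where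

/-- The simplicial cochain complex of simplicial maps from a cosimplicial simplicial set to a complex of
simplicial vector spaces. -/
noncomputable def sectionsComplex (Y : CosimplicialObject SSet.{u})
    (A : CochainComplex (SimplicialObject (ModuleCat.{v} K)) ℕ) :
    CochainComplex (SimplicialObject AddCommGrpCat.{max u v}) ℕ :=
  ((sectionsFunctor K Y).mapHomologicalComplex _).obj A

/-- The equivalence `e` lives between coefficient complexes and does not involve `Y`, so its image
is automatically compatible with the cosimplicial structure. -/
lemma permanent_sectionsComplex_iff {Y : CosimplicialObject SSet.{u}}
    {A B : CochainComplex (SimplicialObject (ModuleCat.{v} K)) ℕ} (e : HomotopyEquiv A B) :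
    (SimplicialCochain.ofComplex (sectionsComplex Y A)).Permanent ↔
      (SimplicialCochain.ofComplex (sectionsComplex Y B)).Permanent :=
  (SimplicialCochain.Hom.isQuasiIso_of_homotopyEquiv
    ((sectionsFunctor K Y).mapHomotopyEquiv e)).permanent_iff

/-- Polynomial forms on a simplicial set are the simplicial maps into `plForms`. -/
def formsEquiv (p : ℕ) (S : SSet.{u}) : forms K S p ≃+ sections (plForms K p) S where
  toFun a := ⟨fun n σ => ⟨a.1 n.unop σ, a.2.1 n.unop σ⟩, fun m n θ σ =>
    Subtype.ext (a.2.2 n.unop m.unop θ.unop σ)⟩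
  invFun a := ⟨fun n σ => (show degree K n.len p from a.1 (op n) σ).1,
    fun n σ => (show degree K n.len p from a.1 (op n) σ).2, fun m n θ σ =>
      congrArg (fun x : degree K m.len p => x.1) (a.2 (op n) (op m) θ.op σ)⟩
  left_inv _ := rfl
  right_inv _ := rfl
  map_add' _ _ := rfl

/-- The cosimplicial singular simplicial set of a cosimplicial space. -/
noncomputable abbrev sing (X : CosimplicialObject TopCat.{u}) : CosimplicialObject SSet.{u} :=
  X ⋙ TopCat.toSSet

/-- The comparison of the complex of the diagram `A_PL(X)` with simplicial maps into `plForms`. -/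
noncomputable def aplHom (K : Type v) [Field K] (X : CosimplicialObject TopCat.{u}) :
    CDGA.complex (X.op ⋙ apl K) ⟶ sectionsComplex (sing X) (plComplex K) :=
  CochainComplex.ofHom
    (fun p => { app m := AddCommGrpCat.ofHom (formsEquiv (K := K) p ((sing X).obj m.unop)).toAddMonoidHom })
    (fun p => by
      rw [CDGA.complex_d]
      refine NatTrans.ext (funext fun m => AddCommGrpCat.hom_ext (AddMonoidHom.ext fun a =>
        Subtype.ext (funext fun n => funext fun σ => Subtype.ext ?_)))
      exact plComplex_d_apply K p n _)

/-- Two injective resolutions of the constants are homotopy equivalent, and simplicial maps into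
`plForms` are the forms of `A_PL`. -/
lemma permanent_cochains [CharZero K] {X : CosimplicialObject TopCat.{u}} (hX : IsFormalDiagram K X) :
    (SimplicialCochain.ofComplex (sectionsComplex (sing X) (cochainComplex K))).Permanent := by
  refine (permanent_sectionsComplex_iff
    ((plResolution K).homotopyEquiv (cochainResolution K))).1 ?_
  refine ((SimplicialCochain.Hom.ofHom (aplHom K X)).isQuasiIso_of_bijective
    fun m q => ?_).permanent (CDGA.IsFormal.permanent hX)
  exact (formsEquiv (K := K) q ((sing X).obj ⦋m⦌)).bijective

/-! ### Singular cochains as functions on singular simplices -/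

/-- Cochains on a simplicial set are functions on the simplices. -/
def cochainEquiv (K : Type v) [Field K] (q : SimplexCategory) (S : SSet.{u}) :
    sections ((simplexCochains K).obj q) S ≃+ (S.obj (op q) → K) where
  toFun a σ := a.1 (op q) σ (𝟙 q)
  invFun c := ⟨fun n σ τ => c (S.map τ.op σ), fun m n θ σ => funext fun τ => by
    change c (S.map τ.op (S.map θ σ)) = c (S.map (τ ≫ θ.unop).op σ)
    rw [op_comp, Functor.map_comp]
    rfl⟩
  left_inv a := Subtype.ext (funext fun n => funext fun σ => funext fun τ =>
    (congrFun (a.2 n (op q) τ.op σ) (𝟙 q)).trans (congrArg (a.1 n σ) (Category.id_comp τ)))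
  right_inv c := funext fun σ => congrArg (fun f : S.obj (op q) ⟶ S.obj (op q) => c (f σ))
    (S.map_id (op q))
  map_add' _ _ := rfl

end PolyForms

namespace PolyForms

open Opposite Simplicial AlgebraicTopology

/-- The simplicial cochain complex of singular cochains of a cosimplicial space. -/
noncomputable abbrev singularCochains (K : Type v) [Field K] (X : CosimplicialObject TopCat.{u}) :
    SimplicialCochain.{max u v} :=
  SimplicialCochain.ofComplex (sectionsComplex (sing X) (cochainComplex K))

variable {K : Type v} [Field K] (X : CosimplicialObject TopCat.{u})

/-- Singular cochains as functions on singular simplices. -/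
noncomputable def evalCochain (m q : ℕ) :
    (singularCochains K X).A m q ≃+ (((sing X).obj ⦋m⦌).obj (op ⦋q⦌) → K) :=
  cochainEquiv K ⦋q⦌ ((sing X).obj ⦋m⦌)

lemma evalCochain_d (m q : ℕ) (c : (singularCochains K X).A m q)
    (σ : ((sing X).obj ⦋m⦌).obj (op ⦋q + 1⦌)) :
    evalCochain X m (q + 1) ((singularCochains K X).d m q c) σ =
      ∑ i : Fin (q + 2), (-1 : ℤ) ^ (i : ℕ) • evalCochain X m q c (((sing X).obj ⦋m⦌).δ i σ) := by
  refine (cochainComplex_d_apply K q (op ⦋q + 1⦌) (c.1 (op ⦋q + 1⦌) σ) (𝟙 _)).trans ?_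
  refine Finset.sum_congr rfl fun i _ => congrArg _ ?_
  refine Eq.trans ?_ (congrFun (c.2 _ _ (SimplexCategory.δ i).op σ) (𝟙 ⦋q⦌)).symm
  exact congrArg (c.1 (op ⦋q + 1⦌) σ) ((Category.comp_id _).trans (Category.id_comp _).symm)

lemma evalCochain_δ (m q : ℕ) (c : (singularCochains K X).A (m + 1) q)
    (σ : ((sing X).obj ⦋m⦌).obj (op ⦋q⦌)) :
    evalCochain X m q ((singularCochains K X).δ m q c) σ =
      ∑ i : Fin (m + 2), (-1 : ℤ) ^ (i : ℕ) •
        evalCochain X (m + 1) q c (((sing X).δ i).app (op ⦋q⦌) σ) := by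
  have h := SimplicialCochain.ofComplex_δ_apply (sectionsComplex (sing X) (cochainComplex K)) m q c
  let ev : (singularCochains K X).A m q →+ K :=
    (Pi.evalAddMonoidHom (fun _ => K) σ).comp (evalCochain (K := K) X m q).toAddMonoidHom
  refine (congrArg ev h).trans ((map_sum ev _ _).trans ?_)
  exact Finset.sum_congr rfl fun i _ => map_zsmul ev _ _

end PolyForms

/-! ### Comparison of coefficient fields through the rationals -/

section Tensor

/-- If all rational coordinates of `∑ zᵢ ⊗ ψᵢ` vanish, then so does `∑ zᵢ ψᵢ`. -/
lemma sum_mul_eq_zero_of_forall_addMonoidHom {L : Type w} [Field L] [CharZero L] {K : Type v}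
    [Field K] [CharZero K] {S : Type u} (z : S →₀ L) (ψ : S → L)
    (h : ∀ α β : L →+ K, (z.sum fun σ l => α l * β (ψ σ)) = 0) :
    (z.sum fun σ l => l * ψ σ) = 0 := by
  -- The coordinates of `t` are values of the hypothesis for `α` and `β` equal to basis coordinates
  -- followed by the embedding of `ℚ` in `K`. Hence `t = 0`, and multiplication `L ⊗ L → L` gives
  -- the claim.
  let b := Module.Basis.ofVectorSpace ℚ L
  let t : L ⊗[ℚ] L := z.sum fun σ l => l ⊗ₜ ψ σ
  have ht : t = 0 := by
    refine (b.tensorProduct b).ext_elem fun ⟨i, j⟩ => ?_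
    have h1 := h ((Rat.castHom K).toAddMonoidHom.comp (b.coord i).toAddMonoidHom)
      ((Rat.castHom K).toAddMonoidHom.comp (b.coord j).toAddMonoidHom)
    have h2 : (((b.tensorProduct b).repr t (i, j) : ℚ) : K) = 0 := by
      refine Eq.trans ?_ h1
      simp only [t, Finsupp.sum, map_sum, Finsupp.finsetSum_apply,
        Module.Basis.tensorProduct_repr_tmul_apply, Rat.cast_sum]
      refine Finset.sum_congr rfl fun σ _ => ?_
      simp [mul_comm]
    rw [map_zero, Finsupp.zero_apply]
    exact_mod_cast h2
  have h3 := congrArg (LinearMap.mul' ℚ L) ht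
  simpa [t, Finsupp.sum, map_sum] using h3

end Tensor

/-! ### Leading terms of boundaries in the total complex -/

namespace CosimplicialComplex

open Simplicial SimplicialCochain

variable {R : Type v} [CommRing R] {V : CosimplicialObject (ChainComplex (ModuleCat.{w} R) ℕ)}
  {C : SimplicialCochain.{u}} {G : Type*} [AddCommGroup G]

/-- A pairing of a cosimplicial chain complex with a simplicial cochain complex. -/
structure Pairing (V : CosimplicialObject (ChainComplex (ModuleCat.{w} R) ℕ))
    (C : SimplicialCochain.{u}) (G : Type*) [AddCommGroup G] where
  pair (m q : ℕ) : (V.obj ⦋m⦌).X q →+ C.A m q →+ G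
  pair_bdry (m q : ℕ) (x : (V.obj ⦋m⦌).X (q + 1)) (c : C.A m q) :
    pair m q (bdry V m (q + 1) q x) c = pair m (q + 1) x (C.d m q c)
  pair_coface (m q : ℕ) (x : (V.obj ⦋m⦌).X q) (c : C.A (m + 1) q) :
    pair (m + 1) q (coface V m (m + 1) q x) c = pair m q x (C.δ m q c)

lemma neg_one_pow_zsmul_eq_zero_iff {M : Type*} [AddCommGroup M] (k : ℕ) (x : M) :
    (-1 : ℤ) ^ k • x = 0 ↔ x = 0 := by
  rcases neg_one_pow_eq_or ℤ k with h | h <;> simp [h]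

/-- The pairing is moved down the staircase: `⟨δ x, c⟩ = ⟨x, δ c⟩ = ⟨x, d b⟩ = ⟨∂ x, b⟩`, and the
vanishing of `D x` replaces `∂ x` by `± δ` of the component one column lower. In column 0 there is
no such component and `∂ x = 0`. -/
lemma pair_coface_eq_zero (P : Pairing V C G) {x : Components V} {m q : ℕ}
    (hx : ∀ i ≤ m, ∀ j, totD V x i j = 0) {c : C.A (m + 1) q} (hc : C.Descends (m + 1) q c) :
    P.pair (m + 1) q (coface V m (m + 1) q (x m q)) c = 0 := by
  induction m generalizing q with
  | zero =>
    rw [P.pair_coface]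
    cases q with
    | zero => rw [show C.δ 0 0 c = 0 from hc, map_zero]
    | succ q =>
      obtain ⟨b, hb, -⟩ := hc
      have h := hx 0 le_rfl q
      have h0 : coface V 0 0 q (x 0 q) = 0 := coface_eq_zero V (by simp) q _
      have h1 : bdry V 0 (q + 1) q (x 0 (q + 1)) = 0 := by
        rw [totD_apply] at h
        refine Eq.trans ?_ h
        refine (add_zero _).symm.trans (congrArg _ ?_)
        exact ((congrArg _ h0).trans (smul_zero _)).symm
      rw [hb, ← P.pair_bdry, h1, map_zero, AddMonoidHom.zero_apply]
  | succ m ih =>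
    rw [P.pair_coface]
    cases q with
    | zero => rw [show C.δ (m + 1) 0 c = 0 from hc, map_zero]
    | succ q =>
      obtain ⟨b, hb, hb'⟩ := hc
      have h : bdry V (m + 1) (q + 1) q (x (m + 1) (q + 1)) +
          (-1 : ℤ) ^ (m + 1 + q) • coface V m (m + 1) q (x m q) = 0 := hx (m + 1) le_rfl q
      rw [hb, ← P.pair_bdry, eq_neg_of_add_eq_zero_left h, map_neg, map_zsmul,
        AddMonoidHom.neg_apply, AddMonoidHom.zsmul_apply,
        ih (fun i hi j => hx i (by omega) j) hb', smul_zero, neg_zero]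

/-- The leading term of a boundary pairs trivially with all cocycles on the second page. -/
lemma pair_totD_eq_zero (P : Pairing V C G) (hC : C.Permanent) {x : Components V} {m q : ℕ}
    (hx : ∀ i < m, ∀ j, totD V x i j = 0) {c : C.A m q} (hc : C.IsSecond m q c) :
    P.pair m q (totD V x m q) c = 0 := by
  obtain ⟨e, he, b, hb, hdesc⟩ := hC m q c hc
  have hDD := totD_totD V x
  -- For a closed cochain that descends, the `∂` part of the leading term pairs to zero by
  -- closedness and the `δ` part by the staircase.
  have h0 : ∀ a, C.d m q a = 0 → C.Descends m q a → P.pair m q (totD V x m q) a = 0 := by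
    intro a hd hdesc
    rw [totD_apply, map_add, AddMonoidHom.add_apply, P.pair_bdry, hd, map_zero, zero_add, map_zsmul,
      AddMonoidHom.zsmul_apply]
    cases m with
    | zero =>
      have h0 : coface V 0 0 q (x 0 q) = 0 := coface_eq_zero V (by simp) q _
      refine (congrArg (fun y => (-1 : ℤ) ^ (0 + q) • P.pair 0 q y _) h0).trans ?_
      rw [map_zero, AddMonoidHom.zero_apply, smul_zero]
    | succ m =>
      refine (congrArg _ (pair_coface_eq_zero P (fun i hi j => hx i (by omega) j) hdesc)).trans ?_
      exact smul_zero _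
  have h1 : P.pair m q (totD V x m q) (c + b + C.δ m q e) = 0 := by
    have hd : C.d m q (c + b + C.δ m q e) = 0 := by
      rw [map_add, map_add, hc.d_eq_zero, d_of_mem_cob hb, C.d_δ, he, map_zero, add_zero, add_zero]
    exact h0 _ hd hdesc
  -- The leading term is a `∂`-cycle because `D D x = 0`, so the coboundary `b` does not contribute.
  have h2 : P.pair m q (totD V x m q) b = 0 := by
    cases q with
    | zero =>
      obtain rfl : b = 0 := hb
      exact map_zero _
    | succ q =>
      obtain ⟨b, rfl⟩ := hb
      have h : bdry V m (q + 1) q (totD V x m (q + 1)) = 0 := by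
        have h := congrFun (congrFun hDD m) q
        rw [totD_apply] at h
        cases m with
        | zero =>
          have h0 : coface V 0 0 q (totD V x 0 q) = 0 := coface_eq_zero V (by simp) q _
          refine Eq.trans ?_ h
          refine (add_zero _).symm.trans (congrArg _ ?_)
          exact ((congrArg _ h0).trans (smul_zero _)).symm
        | succ m =>
          rw [hx (m + 1 - 1) (by omega), map_zero, smul_zero, add_zero] at h
          exact h
      rw [← P.pair_bdry, h, map_zero, AddMonoidHom.zero_apply]
  -- One column further, `D D x = 0` makes `δ` of the leading term a `∂`-boundary up to sign, which
  -- pairs to zero with the cocycle `e`.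
  have h3 : P.pair m q (totD V x m q) (C.δ m q e) = 0 := by
    have h : bdry V (m + 1) (q + 1) q (totD V x (m + 1) (q + 1)) +
        (-1 : ℤ) ^ (m + 1 + q) • coface V m (m + 1) q (totD V x m q) = 0 :=
      congrFun (congrFun hDD (m + 1)) q
    have h' := congrArg (fun y => P.pair (m + 1) q y e) h
    simp only [map_add, AddMonoidHom.add_apply, P.pair_bdry, he, map_zero, zero_add, map_zsmul,
      AddMonoidHom.zsmul_apply, AddMonoidHom.zero_apply, P.pair_coface,
      neg_one_pow_zsmul_eq_zero_iff] at h'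
    exact h'
  rwa [map_add, map_add, h2, h3, add_zero, add_zero] at h1

end CosimplicialComplex

/-! ### Chains and cochains -/

section Pairing

variable {L : Type w} [Field L] {K : Type v} [Field K] {S T : Type u}

/-- The pairing of chains with coefficients in `L` and cochains with coefficients in `K` determined by an
additive map `L → K`. -/
noncomputable def chainPairing (α : L →+ K) : (S →₀ L) →+ (S → K) →+ K :=
  Finsupp.liftAddHom fun σ =>
    { toFun l :=
        { toFun c := α l * c σ
          map_zero' := mul_zero _
          map_add' _ _ := mul_add _ _ _ }
      map_zero' := AddMonoidHom.ext fun c => by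
        change α 0 * c σ = 0
        rw [map_zero, zero_mul]
      map_add' l l' := AddMonoidHom.ext fun c => by
        change α (l + l') * c σ = α l * c σ + α l' * c σ
        rw [map_add, add_mul] }

lemma chainPairing_single (α : L →+ K) (σ : S) (l : L) (c : S → K) :
    chainPairing α (Finsupp.single σ l) c = α l * c σ := by
  rw [chainPairing, Finsupp.liftAddHom_apply_single]
  rfl

lemma chainPairing_apply (α : L →+ K) (z : S →₀ L) (c : S → K) :
    chainPairing α z c = z.sum fun σ l => α l * c σ := by
  rw [chainPairing, Finsupp.liftAddHom_apply, Finsupp.sum, AddMonoidHom.finsetSum_apply]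
  rfl

lemma chainPairing_mapDomain (α : L →+ K) (g : S → T) (z : S →₀ L) (c : T → K) :
    chainPairing α (Finsupp.lmapDomain L L g z) c = chainPairing α z fun σ => c (g σ) := by
  induction z using Finsupp.induction_linear with
  | zero => simp
  | add x y hx hy => simp only [map_add, AddMonoidHom.add_apply, hx, hy]
  | single σ l => rw [Finsupp.lmapDomain_apply, Finsupp.mapDomain_single, chainPairing_single,
      chainPairing_single]

lemma chainPairing_sum_mapDomain (α : L →+ K) {k : ℕ} (g : Fin k → S → T) (z : S →₀ L) (c : T → K) :
    chainPairing α (∑ i : Fin k, (-1 : ℤ) ^ (i : ℕ) • Finsupp.lmapDomain L L (g i) z) c =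
      chainPairing α z fun σ => ∑ i : Fin k, (-1 : ℤ) ^ (i : ℕ) • c (g i σ) := by
  have h : (fun σ => ∑ i : Fin k, (-1 : ℤ) ^ (i : ℕ) • c (g i σ)) =
      ∑ i : Fin k, (-1 : ℤ) ^ (i : ℕ) • fun σ => c (g i σ) := by
    funext σ
    rw [Finset.sum_apply]
    rfl
  rw [h, map_sum, map_sum, AddMonoidHom.finsetSum_apply]
  refine Finset.sum_congr rfl fun i _ => ?_
  rw [map_zsmul, map_zsmul, AddMonoidHom.zsmul_apply, chainPairing_mapDomain]

end Pairing

/-! ### Normalized singular chains as a retract of all singular chains -/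

namespace NormalizedChains

open Opposite Simplicial AlgebraicTopology CosimplicialComplex PolyForms

variable (L : Type w) [Field L] (X : CosimplicialObject TopCat.{u})

/-- The normalized singular chains of a cosimplicial space. -/
noncomputable abbrev chains : CosimplicialObject (ChainComplex (ModuleCat.{max u w} L) ℕ) :=
  ((CosimplicialObject.whiskering _ _).obj (normalizedSingularChains.{u, w} L)).obj X

/-- The free simplicial vector space on a simplicial set. -/
noncomputable abbrev free (S : SSet.{u}) : SimplicialObject (ModuleCat.{max u w} L) :=
  ((SimplicialObject.whiskering _ _).obj (freeModuleFunctor.{u, w} L)).obj S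

/-- The inclusion of the normalized chains into all chains. -/
noncomputable def incl (m q : ℕ) :
    ((chains L X).obj ⦋m⦌).X q →ₗ[L] ((((sing X).obj ⦋m⦌).obj (op ⦋q⦌)) →₀ L) :=
  ((inclusionOfMooreComplexMap (free L ((sing X).obj ⦋m⦌))).f q).hom

/-- The retraction of all chains onto the normalized chains. -/
noncomputable def retr (m q : ℕ) :
    ((((sing X).obj ⦋m⦌).obj (op ⦋q⦌)) →₀ L) →ₗ[L] ((chains L X).obj ⦋m⦌).X q :=
  ((DoldKan.PInftyToNormalizedMooreComplex (free L ((sing X).obj ⦋m⦌))).f q).hom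

/-- The boundary of singular chains. -/
noncomputable def chainBdry (m q : ℕ) :
    ((((sing X).obj ⦋m⦌).obj (op ⦋q + 1⦌)) →₀ L) →ₗ[L] ((((sing X).obj ⦋m⦌).obj (op ⦋q⦌)) →₀ L) :=
  (((alternatingFaceMapComplex _).obj (free L ((sing X).obj ⦋m⦌))).d (q + 1) q).hom

/-- The alternating sum of the cofaces on singular chains. -/
noncomputable def chainCoface (m q : ℕ) :
    ((((sing X).obj ⦋m⦌).obj (op ⦋q⦌)) →₀ L) →ₗ[L] ((((sing X).obj ⦋m + 1⦌).obj (op ⦋q⦌)) →₀ L) :=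
  ∑ i : Fin (m + 2), (-1 : ℤ) ^ (i : ℕ) •
    Finsupp.lmapDomain L L fun σ => ((sing X).δ i).app (op ⦋q⦌) σ

lemma chainBdry_apply (m q : ℕ) (z : (((sing X).obj ⦋m⦌).obj (op ⦋q + 1⦌)) →₀ L) :
    chainBdry L X m q z = ∑ i : Fin (q + 2), (-1 : ℤ) ^ (i : ℕ) •
      Finsupp.lmapDomain L L (fun σ => ((sing X).obj ⦋m⦌).δ i σ) z := by
  have h : ((alternatingFaceMapComplex _).obj (free L ((sing X).obj ⦋m⦌))).d (q + 1) q =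
      ∑ i : Fin (q + 2), (-1 : ℤ) ^ (i : ℕ) • (free L ((sing X).obj ⦋m⦌)).δ i :=
    alternatingFaceMapComplex_obj_d _ q
  let ev : ((((alternatingFaceMapComplex _).obj (free L ((sing X).obj ⦋m⦌))).X (q + 1)) ⟶
      (((alternatingFaceMapComplex _).obj (free L ((sing X).obj ⦋m⦌))).X q)) →+
        ((((sing X).obj ⦋m⦌).obj (op ⦋q⦌)) →₀ L) :=
    { toFun f := f.hom z
      map_zero' := rfl
      map_add' _ _ := rfl }
  refine (congrArg ev h).trans ((map_sum ev _ _).trans ?_)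
  exact Finset.sum_congr rfl fun i _ => map_zsmul ev _ _

lemma chainCoface_apply (m q : ℕ) (z : (((sing X).obj ⦋m⦌).obj (op ⦋q⦌)) →₀ L) :
    chainCoface L X m q z = ∑ i : Fin (m + 2), (-1 : ℤ) ^ (i : ℕ) •
      Finsupp.lmapDomain L L (fun σ => ((sing X).δ i).app (op ⦋q⦌) σ) z := by
  rw [chainCoface, LinearMap.sum_apply]
  rfl

lemma retr_incl (m q : ℕ) (x : ((chains L X).obj ⦋m⦌).X q) : retr L X m q (incl L X m q x) = x :=
  congrArg (fun f => (f.f q).hom x)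
    (DoldKan.splitMonoInclusionOfMooreComplexMap (free L ((sing X).obj ⦋m⦌))).id

lemma incl_bdry (m q : ℕ) (x : ((chains L X).obj ⦋m⦌).X (q + 1)) :
    incl L X m q (bdry (chains L X) m (q + 1) q x) = chainBdry L X m q (incl L X m (q + 1) x) :=
  congrArg (fun f => f.hom x)
    ((inclusionOfMooreComplexMap (free L ((sing X).obj ⦋m⦌))).comm (q + 1) q).symm

lemma retr_chainBdry (m q : ℕ) (z : (((sing X).obj ⦋m⦌).obj (op ⦋q + 1⦌)) →₀ L) :
    retr L X m q (chainBdry L X m q z) = bdry (chains L X) m (q + 1) q (retr L X m (q + 1) z) :=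
  congrArg (fun f => f.hom z)
    ((DoldKan.PInftyToNormalizedMooreComplex (free L ((sing X).obj ⦋m⦌))).comm (q + 1) q).symm

lemma incl_coface (m q : ℕ) (x : ((chains L X).obj ⦋m⦌).X q) :
    incl L X (m + 1) q (coface (chains L X) m (m + 1) q x) =
      chainCoface L X m q (incl L X m q x) := by
  rw [coface_succ, map_sum, chainCoface_apply]
  refine Finset.sum_congr rfl fun i _ => (map_zsmul _ _ _).trans (congrArg _ ?_)
  exact congrArg (fun f => (f.f q).hom x) ((inclusionOfMooreComplex (ModuleCat.{max u w} L)).naturality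
    (((SimplicialObject.whiskering _ _).obj (freeModuleFunctor.{u, w} L)).map ((sing X).δ i)))

lemma retr_chainCoface (m q : ℕ) (z : (((sing X).obj ⦋m⦌).obj (op ⦋q⦌)) →₀ L) :
    retr L X (m + 1) q (chainCoface L X m q z) =
      coface (chains L X) m (m + 1) q (retr L X m q z) := by
  rw [coface_succ, chainCoface_apply, map_sum]
  refine Finset.sum_congr rfl fun i _ => (map_zsmul _ _ _).trans (congrArg _ ?_)
  exact congrArg (fun f => (f.f q).hom z) (DoldKan.PInftyToNormalizedMooreComplex_naturality
    (((SimplicialObject.whiskering _ _).obj (freeModuleFunctor.{u, w} L)).map ((sing X).δ i)))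

variable {L}

/-- The pairing of normalized singular chains with singular cochains. -/
noncomputable def singularPairing {K : Type v} [Field K] (α : L →+ K) :
    Pairing (chains L X) (singularCochains K X) K where
  pair m q := ((chainPairing α).compl₂ (evalCochain X m q).toAddMonoidHom).comp
    (incl L X m q).toAddMonoidHom
  pair_bdry m q x c := by
    change chainPairing α (incl L X m q (bdry (chains L X) m (q + 1) q x)) (evalCochain X m q c) =
      chainPairing α (incl L X m (q + 1) x) (evalCochain X m (q + 1) _)
    rw [incl_bdry, chainBdry_apply, chainPairing_sum_mapDomain]
    exact congrArg _ (funext fun σ => (evalCochain_d X m q c σ).symm)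
  pair_coface m q x c := by
    change chainPairing α (incl L X (m + 1) q (coface (chains L X) m (m + 1) q x))
      (evalCochain X (m + 1) q c) = chainPairing α (incl L X m q x) (evalCochain X m q _)
    rw [incl_coface, chainCoface_apply, chainPairing_sum_mapDomain]
    exact congrArg _ (funext fun σ => (evalCochain_δ X m q c σ).symm)

end NormalizedChains

/-! ### Functionals on normalized chains as singular cochains -/

namespace NormalizedChains

open Opposite Simplicial AlgebraicTopology CosimplicialComplex PolyForms

variable {L : Type w} [Field L] (X : CosimplicialObject TopCat.{u})

/-- The functional on singular chains determined by its values on simplices. -/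
lemma apply_chain_eq_sum {S : Type u} {M : Type*} [AddCommGroup M] [Module L M] (f : M →ₗ[L] L)
    (r : (S →₀ L) →ₗ[L] M) (z : S →₀ L) :
    f (r z) = z.sum fun σ l => l * f (r (Finsupp.single σ 1)) := by
  conv_lhs => rw [← Finsupp.sum_single z]
  rw [Finsupp.sum, Finsupp.sum, map_sum, map_sum]
  refine Finset.sum_congr rfl fun σ _ => ?_
  rw [← smul_eq_mul, ← map_smul, ← map_smul, Finsupp.smul_single, smul_eq_mul, mul_one]

lemma sum_retr_δ (m q : ℕ) (f : ((chains L X).obj ⦋m⦌).X q →ₗ[L] L)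
    (σ : ((sing X).obj ⦋m⦌).obj (op ⦋q + 1⦌)) :
    ∑ i : Fin (q + 2), (-1 : ℤ) ^ (i : ℕ) •
        f (retr L X m q (Finsupp.single (((sing X).obj ⦋m⦌).δ i σ) 1)) =
      f (bdry (chains L X) m (q + 1) q (retr L X m (q + 1) (Finsupp.single σ 1))) := by
  rw [← retr_chainBdry, chainBdry_apply, map_sum, map_sum]
  refine Finset.sum_congr rfl fun i _ => ?_
  rw [map_zsmul, map_zsmul, Finsupp.lmapDomain_apply, Finsupp.mapDomain_single]

lemma sum_retr_coface (m q : ℕ) (f : ((chains L X).obj ⦋m + 1⦌).X q →ₗ[L] L)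
    (σ : ((sing X).obj ⦋m⦌).obj (op ⦋q⦌)) :
    ∑ i : Fin (m + 2), (-1 : ℤ) ^ (i : ℕ) •
        f (retr L X (m + 1) q (Finsupp.single (((sing X).δ i).app (op ⦋q⦌) σ) 1)) =
      f (coface (chains L X) m (m + 1) q (retr L X m q (Finsupp.single σ 1))) := by
  rw [← retr_chainCoface, chainCoface_apply, map_sum, map_sum]
  refine Finset.sum_congr rfl fun i _ => ?_
  rw [map_zsmul, map_zsmul, Finsupp.lmapDomain_apply, Finsupp.mapDomain_single]

/-- The singular cochain determined by a functional on normalized chains and a map of coefficients. -/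
noncomputable def functionalCochain {K : Type v} [Field K] (m q : ℕ)
    (f : ((chains L X).obj ⦋m⦌).X q →ₗ[L] L) (β : L →+ K) : (singularCochains K X).A m q :=
  (evalCochain X m q).symm fun σ => β (f (retr L X m q (Finsupp.single σ 1)))

variable {K : Type v} [Field K]

lemma functionalCochain_d (m q : ℕ) (f : ((chains L X).obj ⦋m⦌).X q →ₗ[L] L) (β : L →+ K) :
    (singularCochains K X).d m q (functionalCochain X m q f β) =
      functionalCochain X m (q + 1) (f.comp (bdry (chains L X) m (q + 1) q)) β := by
  refine (evalCochain X m (q + 1)).injective (funext fun σ => ?_)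
  rw [evalCochain_d, functionalCochain, functionalCochain, AddEquiv.apply_symm_apply,
    AddEquiv.apply_symm_apply, LinearMap.comp_apply, ← sum_retr_δ, map_sum]
  simp only [map_zsmul]

lemma functionalCochain_δ (m q : ℕ) (f : ((chains L X).obj ⦋m + 1⦌).X q →ₗ[L] L) (β : L →+ K) :
    (singularCochains K X).δ m q (functionalCochain X (m + 1) q f β) =
      functionalCochain X m q (f.comp (coface (chains L X) m (m + 1) q)) β := by
  refine (evalCochain X m q).injective (funext fun σ => ?_)
  rw [evalCochain_δ, functionalCochain, functionalCochain, AddEquiv.apply_symm_apply,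
    AddEquiv.apply_symm_apply, LinearMap.comp_apply, ← sum_retr_coface, map_sum]
  simp only [map_zsmul]

lemma functionalCochain_zero (m q : ℕ) (β : L →+ K) : functionalCochain X m q 0 β = 0 := by
  refine (evalCochain X m q).injective (funext fun σ => ?_)
  rw [functionalCochain, AddEquiv.apply_symm_apply, map_zero, LinearMap.zero_apply, map_zero]
  rfl

lemma singularPairing_functionalCochain (m q : ℕ) (f : ((chains L X).obj ⦋m⦌).X q →ₗ[L] L)
    (α β : L →+ K) (x : ((chains L X).obj ⦋m⦌).X q) :
    (singularPairing X α).pair m q x (functionalCochain X m q f β) =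
      (incl L X m q x).sum fun σ l => α l * β (f (retr L X m q (Finsupp.single σ 1))) := by
  change chainPairing α (incl L X m q x) (evalCochain X m q (functionalCochain X m q f β)) = _
  rw [functionalCochain, AddEquiv.apply_symm_apply, chainPairing_apply]

/-- A functional factors through a linear map whose kernel it annihilates. -/
lemma exists_comp_eq_of_ker_le {M N : Type*} [AddCommGroup M] [Module L M] [AddCommGroup N]
    [Module L N] (g : M →ₗ[L] N) (f : M →ₗ[L] L) (h : LinearMap.ker g ≤ LinearMap.ker f) :
    ∃ e : N →ₗ[L] L, f = e.comp g := by
  obtain ⟨e, he⟩ := LinearMap.exists_extend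
    (((LinearMap.ker g).liftQ f h).comp g.quotKerEquivRange.symm.toLinearMap)
  refine ⟨e, LinearMap.ext fun x => ?_⟩
  have h1 := LinearMap.congr_fun he (g.quotKerEquivRange (Submodule.Quotient.mk x))
  simp only [LinearMap.comp_apply, LinearEquiv.coe_coe, LinearEquiv.symm_apply_apply,
    Submodule.liftQ_apply, Submodule.subtype_apply, LinearMap.quotKerEquivRange_apply_mk] at h1
  exact h1.symm

/-- The leading term of a boundary in the total complex is trivial on the second page. -/
theorem totD_mem_of_permanent [CharZero L] [CharZero K] (hC : (singularCochains K X).Permanent)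
    {x : Components (chains L X)} {m q : ℕ} (hx : ∀ i < m, ∀ j, totD (chains L X) x i j = 0) :
    totD (chains L X) x m q ∈ LinearMap.range (bdry (chains L X) m (q + 1) q) ⊔
      (LinearMap.ker (bdry (chains L X) (m - 1) q (q - 1))).map
        (coface (chains L X) (m - 1) m q) := by
  by_contra hw
  -- A functional separates the leading term from the subspace. It remains to see that it defines
  -- second-page cocycles and to evaluate the pairing.
  obtain ⟨f, hfw, hf⟩ := Submodule.exists_le_ker_of_notMem hw
  refine hfw ?_
  have hb : f.comp (bdry (chains L X) m (q + 1) q) = 0 := LinearMap.ext fun y =>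
    hf (Submodule.mem_sup_left ⟨y, rfl⟩)
  have hsecond : ∀ β : L →+ K, (singularCochains K X).IsSecond m q (functionalCochain X m q f β) := by
    intro β
    have hd : (singularCochains K X).d m q (functionalCochain X m q f β) = 0 := by
      rw [functionalCochain_d, hb, functionalCochain_zero]
    cases m with
    | zero => exact hd
    | succ m =>
      refine ⟨hd, ?_⟩
      rw [functionalCochain_δ]
      have hker : LinearMap.ker (bdry (chains L X) m q (q - 1)) ≤
          LinearMap.ker (f.comp (coface (chains L X) m (m + 1) q)) := fun y hy =>
        hf (Submodule.mem_sup_right ⟨y, hy, rfl⟩)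
      cases q with
      | zero =>
        -- Here `q - 1` is truncated to 0 and the boundary vanishes, so every 0-chain is a cycle and
        -- `f` kills all cofaces.
        have h0 : bdry (chains L X) m 0 0 = 0 := LinearMap.ext fun y =>
          congrArg (fun g => g.hom y) (((chains L X).obj ⦋m⦌).shape 0 0 (by simp))
        have h1 : f.comp (coface (chains L X) m (m + 1) 0) = 0 := LinearMap.ext fun y =>
          hker (show bdry (chains L X) m 0 0 y = 0 by rw [h0, LinearMap.zero_apply])
        rw [h1, functionalCochain_zero]
        exact zero_mem _
      | succ q =>
        -- As `f ∘ δ` kills the `∂`-cycles it factors through `∂`; dually, `δ` of the cochain of `f`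
        -- is the coboundary of the cochain of `e`.
        obtain ⟨e, he⟩ := exists_comp_eq_of_ker_le (bdry (chains L X) m (q + 1) q) _ hker
        rw [he, ← functionalCochain_d]
        exact ⟨_, rfl⟩
  have h := sum_mul_eq_zero_of_forall_addMonoidHom (K := K) (incl L X m q (totD (chains L X) x m q))
    (fun σ => f (retr L X m q (Finsupp.single σ 1))) fun α β => by
      rw [← singularPairing_functionalCochain]
      exact pair_totD_eq_zero _ hC hx (hsecond β)
  rwa [← apply_chain_eq_sum, retr_incl] at h

end NormalizedChains

/-! ### Conormalization -/

namespace CosimplicialComplex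

open Opposite Simplicial AlgebraicTopology

variable {R : Type v} [CommRing R]
  (V : CosimplicialObject (ChainComplex (ModuleCat.{w} R) ℕ))

/-- The projection of a cosimplicial chain complex onto its conormalization. -/
noncomputable def conormProj (m : ℕ) : V.obj ⦋m⦌ ⟶ V.obj ⦋m⦌ :=
  ((DoldKan.PInfty (X := (Functor.op V : SimplicialObject _))).f m).unop

/-- `PInfty` annihilates degeneracies of the opposite simplicial object. Read in `V`, codegeneracies
annihilate its image. -/
lemma conormProj_mem (m q : ℕ) (x : (V.obj ⦋m⦌).X q) :
    ((conormProj V m).f q).hom x ∈ conorm V m q := by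
  cases m with
  | zero => trivial
  | succ m =>
    rw [mem_conorm_succ]
    intro j
    exact congrArg (fun f => (f.unop.f q).hom x)
      (DoldKan.σ_comp_PInfty (Functor.op V : SimplicialObject _) j)

/-- The complement `QInfty` is a sum of maps ending in a degeneracy; reversing arrows, a
codegeneracy is applied first and kills `x`. -/
lemma conormProj_of_mem {m q : ℕ} {x : (V.obj ⦋m⦌).X q} (hx : x ∈ conorm V m q) :
    ((conormProj V m).f q).hom x = x := by
  cases m with
  | zero => rfl
  | succ m =>
    rw [mem_conorm_succ] at hx
    let W : SimplicialObject _ := Functor.op V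
    let ev : (W.obj (op ⦋m + 1⦌) ⟶ W.obj (op ⦋m + 1⦌)) →+ (V.obj ⦋m + 1⦌).X q :=
      { toFun f := (f.unop.f q).hom x
        map_zero' := rfl
        map_add' _ _ := rfl }
    have h0 := DoldKan.PInfty_f_add_QInfty_f (X := W) (m + 1)
    have h1 : ev ((DoldKan.PInfty (X := W)).f (m + 1)) +
        ev ((DoldKan.QInfty (X := W)).f (m + 1)) = x :=
      (map_add ev ((DoldKan.PInfty (X := W)).f (m + 1))
        ((DoldKan.QInfty (X := W)).f (m + 1))).symm.trans (congrArg ev h0)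
    have key (g : W.obj (op ⦋m + 1⦌) ⟶ W.obj (op ⦋m + 1⦌)) (i : Fin (m + 1)) :
        ev (g ≫ W.δ i.succ ≫ W.σ i) = 0 := by
      change (g.unop.f q).hom (((V.δ i.succ).f q).hom (((V.σ i).f q).hom x)) = 0
      rw [hx, map_zero, map_zero]
    have h2 : ev ((DoldKan.QInfty (X := W)).f (m + 1)) = 0 := by
      rw [DoldKan.QInfty_f, DoldKan.decomposition_Q]
      exact (map_sum ev _ _).trans (Finset.sum_eq_zero fun i _ => key _ i.rev)
    rw [h2, add_zero] at h1
    exact h1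

lemma conormProj_bdry (m q q' : ℕ) (x : (V.obj ⦋m⦌).X q) :
    ((conormProj V m).f q').hom (bdry V m q q' x) = bdry V m q q' (((conormProj V m).f q).hom x) :=
  congrArg (fun f => f.hom x) ((conormProj V m).comm q q').symm

/-- `PInfty` is a chain map for the alternating face complex of the opposite object, whose
differential is the alternating sum of cofaces. -/
lemma conormProj_coface (m q : ℕ) (x : (V.obj ⦋m⦌).X q) :
    ((conormProj V (m + 1)).f q).hom (coface V m (m + 1) q x) =
      coface V m (m + 1) q (((conormProj V m).f q).hom x) := by
  let W : SimplicialObject _ := Functor.op V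
  have h := (DoldKan.PInfty (X := W)).comm (m + 1) m
  have hd : ((alternatingFaceMapComplex _).obj W).d (m + 1) m =
      ∑ i : Fin (m + 2), (-1 : ℤ) ^ (i : ℕ) • (V.δ i).op := alternatingFaceMapComplex_obj_d W m
  have hd' : (((alternatingFaceMapComplex _).obj W).d (m + 1) m).unop =
      ∑ i : Fin (m + 2), (-1 : ℤ) ^ (i : ℕ) • V.δ i := by
    rw [hd, unop_sum]
    rfl
  have hc : ∀ y, coface V m (m + 1) q y =
      (((((alternatingFaceMapComplex _).obj W).d (m + 1) m).unop).f q).hom y := by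
    intro y
    rw [hd', sum_zsmul_f_apply, coface_succ]
  rw [hc, hc]
  exact congrArg (fun f => (f.unop.f q).hom x) h

end CosimplicialComplex

/-! ### A criterion for the vanishing of a differential -/

namespace FilteredComplex

variable {R : Type v} [CommRing R] (T : FilteredComplex.{v, w} R)

/-- A differential vanishes if every element which it is defined on can be corrected, in higher
filtration, to one whose boundary has higher filtration than prescribed. -/
lemma dE_eq_zero {r p n : ℤ}
    (h : ∀ x ∈ T.Z r p n, ∃ y ∈ T.F (p + 1) n,
      (T.C.d n (n - 1)).hom (x - y) ∈ T.F (p + r + 1) (n - 1)) :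
    T.dE r p n = 0 := by
  refine LinearMap.ext fun x => ?_
  obtain ⟨⟨x, hx⟩, rfl⟩ := Submodule.Quotient.mk_surjective _ x
  refine (Submodule.Quotient.mk_eq_zero _).2 ?_
  change (T.C.d n (n - 1)).hom x ∈ T.B r (p + r) (n - 1)
  obtain ⟨y, hyF, hxy⟩ := h x hx
  have e : (T.C.d n (n - 1)).hom x = (T.C.d n (n - 1)).hom (x - y) + (T.C.d n (n - 1)).hom y := by
    rw [← map_add, sub_add_cancel]
  have hyd : (T.C.d n (n - 1)).hom y ∈ T.F (p + r) (n - 1) := by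
    have hxd : (T.C.d n (n - 1)).hom x ∈ T.F (p + r) (n - 1) := hx.2
    have hle := T.F_succ_le _ _ hxy
    rwa [e, add_mem_cancel_left hle] at hxd
  rw [e]
  -- The two summands of `d x` lie in the two parts of `B`: the first is a cycle of filtration `p +
  -- r + 1`, the second is the boundary of `y`, which lies in `Z^{r-1}_{p+1}`.
  refine Submodule.add_mem_sup ⟨hxy, ?_⟩ ?_
  · change (T.C.d (n - 1) (n - 1 - 1)).hom ((T.C.d n (n - 1)).hom (x - y)) ∈ T.F _ _
    rw [T.d_d_apply]
    exact zero_mem _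
  · have h1 : p + r - r + 1 = p + 1 := by ring
    have h2 : n - 1 + 1 = n := sub_add_cancel n 1
    have h3 : p + 1 + (r - 1) = p + r := by ring
    rw [h1, h2]
    refine ⟨y, ⟨hyF, ?_⟩, rfl⟩
    rwa [h3]

end FilteredComplex

/-! ### Correction of leading terms and the collapse -/

namespace CosimplicialComplex

open Simplicial

variable {R : Type v} [CommRing R]
  {V : CosimplicialObject (ChainComplex (ModuleCat.{w} R) ℕ)}

/-- The family of components with the single entry `a` in bidegree `(m, q)`. -/
def single (m q : ℕ) (a : (V.obj ⦋m⦌).X q) : Components V := Pi.single m (Pi.single q a)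

lemma single_apply_same (m q j : ℕ) (a : (V.obj ⦋m⦌).X q) :
    single m q a m j = (Pi.single q a : ∀ j, (V.obj ⦋m⦌).X j) j := by
  rw [single, Pi.single_eq_same]

lemma single_apply_of_ne {m q i : ℕ} (h : i ≠ m) (j : ℕ) (a : (V.obj ⦋m⦌).X q) :
    single m q a i j = 0 := by
  rw [single, Pi.single_eq_of_ne h]
  rfl

lemma single_mem {m q : ℕ} {n : ℤ} (h : (q : ℤ) = m + n) {a : (V.obj ⦋m⦌).X q}
    (ha : a ∈ conorm V m q) : single m q a ∈ totX V n := by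
  intro i j
  by_cases hi : i = m
  · subst hi
    rw [single_apply_same]
    by_cases hj : j = q
    · subst hj
      rw [Pi.single_eq_same]
      exact ⟨ha, fun h' => absurd h h'⟩
    · rw [Pi.single_eq_of_ne hj]
      exact ⟨zero_mem _, fun _ => rfl⟩
  · rw [single_apply_of_ne hi]
    exact ⟨zero_mem _, fun _ => rfl⟩

lemma totD_single_of_lt {m q i : ℕ} (h : i < m) (j : ℕ) (a : (V.obj ⦋m⦌).X q) :
    totD V (single m q a) i j = 0 := by
  rw [totD_apply, single_apply_of_ne h.ne, single_apply_of_ne (by omega), map_zero, map_zero,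
    smul_zero, add_zero]

lemma totD_single_same (m q j : ℕ) (a : (V.obj ⦋m⦌).X q) : totD V (single m q a) m j =
    bdry V m (j + 1) j ((Pi.single q a : ∀ j, (V.obj ⦋m⦌).X j) (j + 1)) := by
  rw [totD_apply, single_apply_same]
  cases m with
  | zero =>
    have h0 : coface V 0 0 j (single 0 q a 0 j) = 0 := coface_eq_zero V (by simp) j _
    exact (congrArg _ ((congrArg _ h0).trans (smul_zero _))).trans (add_zero _)
  | succ m => rw [single_apply_of_ne (by omega), map_zero, smul_zero, add_zero]

lemma totD_single_succ (m q : ℕ) (a : (V.obj ⦋m⦌).X q) :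
    totD V (single m q a) (m + 1) q = (-1 : ℤ) ^ (m + 1 + q) • coface V m (m + 1) q a := by
  rw [totD_apply, single_apply_of_ne (by omega), map_zero, zero_add]
  change _ • coface V m (m + 1) q (single m q a m q) = _
  rw [single_apply_same, Pi.single_eq_same]

/-- A boundary whose leading term is the sum of an internal boundary and of the coface of an
internal cycle has the same leading term as the boundary of an element of filtration at most one
lower. -/
lemma exists_totD_eq {m q : ℕ} {n : ℤ} (hq : (q : ℤ) + 1 = m + n) {w : (V.obj ⦋m⦌).X q}
    (hw : w ∈ conorm V m q)
    (h : w ∈ LinearMap.range (bdry V m (q + 1) q) ⊔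
      (LinearMap.ker (bdry V (m - 1) q (q - 1))).map (coface V (m - 1) m q)) :
    ∃ y ∈ totX V n, (∀ i j, i + 1 < m → y i j = 0) ∧ (∀ i < m, ∀ j, totD V y i j = 0) ∧
      totD V y m q = w := by
  obtain ⟨_, ⟨a, rfl⟩, _, ⟨b, hb, rfl⟩, hab⟩ := Submodule.mem_sup.1 h
  have ha' : totD V (single m (q + 1) (((conormProj V m).f (q + 1)).hom a)) m q =
      bdry V m (q + 1) q (((conormProj V m).f (q + 1)).hom a) := by
    rw [totD_single_same, Pi.single_eq_same]
  have hmem : single m (q + 1) (((conormProj V m).f (q + 1)).hom a) ∈ totX V n :=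
    single_mem (by push_cast; exact hq) (conormProj_mem V m (q + 1) a)
  -- The given decomposition of `w` need not be conormalized. The projection fixes `w` and commutes
  -- with `∂` and `δ`, so it makes both parts conormalized.
  rw [← conormProj_of_mem V hw, ← hab, map_add, conormProj_bdry]
  cases m with
  | zero =>
    refine ⟨_, hmem, fun i j hi => by omega, fun i hi => by omega, ?_⟩
    -- For `m = 0` the index `m - 1` is truncated to 0 and the coface term is zero.
    have h0 : coface V 0 0 q b = 0 := coface_eq_zero V (by simp) q _
    exact ha'.trans ((add_zero _).symm.trans
      (congrArg _ ((map_zero _).symm.trans (congrArg _ h0.symm))))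
  | succ m =>
    have hb' : bdry V m q (q - 1) b = 0 := hb
    -- The sign cancels the one in front of the coface in the total differential.
    let c : (V.obj ⦋m⦌).X q := (-1 : ℤ) ^ (m + 1 + q) • ((conormProj V m).f q).hom b
    have hc : c ∈ conorm V m q := zsmul_mem (conormProj_mem V m q b) _
    have hcb : bdry V m q (q - 1) c = 0 := by
      rw [map_zsmul, ← conormProj_bdry, hb', map_zero, smul_zero]
    refine ⟨single m q c + single (m + 1) (q + 1) (((conormProj V (m + 1)).f (q + 1)).hom a),
      add_mem (single_mem (by push_cast at hq; omega) hc) hmem, fun i j hi => ?_,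
      fun i hi j => ?_, ?_⟩
    · rw [Pi.add_apply, Pi.add_apply, single_apply_of_ne (by omega), single_apply_of_ne (by omega),
        add_zero]
    · rw [map_add, Pi.add_apply, Pi.add_apply, totD_single_of_lt hi, add_zero]
      obtain hi | rfl := (Nat.lt_succ_iff.1 hi).lt_or_eq
      · exact totD_single_of_lt hi j c
      -- In its own column `c` contributes only `∂ c`, which is zero since `b` is a cycle; this
      -- keeps the leading term in column `m + 1`.
      · rw [totD_single_same]
        by_cases hj : j + 1 = q
        · subst hj
          rw [Pi.single_eq_same]
          exact hcb
        · rw [Pi.single_eq_of_ne hj, map_zero]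
    · rw [map_add, Pi.add_apply, Pi.add_apply, ha', totD_single_succ]
      refine (add_comm _ _).trans (congrArg _ ?_)
      rw [map_zsmul, smul_smul, ← mul_pow, neg_one_mul, neg_neg, one_pow, one_smul]
      exact (conormProj_coface V m q b).symm

lemma totD_eq_zero_of_ne {n : ℤ} {x : Components V} (hx : x ∈ totX V n) {m q : ℕ}
    (h : (q : ℤ) + 1 ≠ m + n) : totD V x m q = 0 :=
  ((totD_mem V (sub_add_cancel n 1) hx) m q).2 (by omega)

/-- If the leading term of every boundary in the total complex is the sum of an internal boundary
and of the coface of an internal cycle, then the spectral sequence collapses at the second page. -/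
theorem collapsesAt_two
    (hV : ∀ (x : Components V) (m q : ℕ), (∀ i < m, ∀ j, totD V x i j = 0) →
      totD V x m q ∈ LinearMap.range (bdry V m (q + 1) q) ⊔
        (LinearMap.ker (bdry V (m - 1) q (q - 1))).map (coface V (m - 1) m q)) :
    (filtered V).CollapsesAt 2 := by
  intro r p n hr
  refine (filtered V).dE_eq_zero fun x hx => ?_
  change totX V n at x
  have hn : n - 1 + 1 = n := sub_add_cancel n 1
  have hd : ∀ z : totX V n, (((tot V).d n (n - 1)).hom z : totX V (n - 1)).1 = totD V z.1 :=
    tot_d_apply V hn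
  suffices h : ∃ y : totX V n, y ∈ (filtered V).F (p + 1) n ∧
      ∀ m q : ℕ, (m : ℤ) < p + r + 1 → totD V (x.1 - y.1) m q = 0 by
    obtain ⟨y, hyF, hy⟩ := h
    exact ⟨y, hyF, fun m q hm => (congrFun (congrFun (hd (x - y)) m) q).trans (hy m q hm)⟩
  have hx0 : ∀ m q : ℕ, (m : ℤ) < p + r → totD V x.1 m q = 0 := by
    intro m q hm
    rw [← hd]
    exact hx.2 m q hm
  -- In these cases column `p + r` does not exist or the leading component would have negative chain
  -- degree, so nothing has to be corrected.
  by_cases hm : p + r < 0 ∨ p + r + n < 1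
  · refine ⟨0, zero_mem _, fun m q hm' => ?_⟩
    rw [ZeroMemClass.coe_zero, sub_zero]
    by_cases hmp : (m : ℤ) < p + r
    · exact hx0 m q hmp
    · exact totD_eq_zero_of_ne x.2 (by omega)
  · obtain ⟨m, hm0⟩ : ∃ m : ℕ, (m : ℤ) = p + r := ⟨(p + r).toNat, by omega⟩
    obtain ⟨q, hq⟩ : ∃ q : ℕ, (q : ℤ) + 1 = m + n := ⟨(m + n - 1).toNat, by omega⟩
    have hlt : ∀ i < m, ∀ j, totD V x.1 i j = 0 := fun i hi j => hx0 i j (by omega)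
    obtain ⟨y, hy, hyF, hy0, hyw⟩ := exists_totD_eq hq
      ((totD_mem V hn x.2) m q).1 (hV x.1 m q hlt)
    -- The correction lives in columns at least `m - 1 = p + r - 1`. This is at least `p + 1`
    -- exactly because `r ≥ 2`.
    refine ⟨⟨y, hy⟩, fun i j hi => hyF i j (by omega), fun i j hi => ?_⟩
    rw [map_sub, Pi.sub_apply, Pi.sub_apply]
    by_cases him : i < m
    · rw [hlt i him, hy0 i him, sub_zero]
    · obtain rfl : i = m := by omega
      by_cases hj : j = q
      · subst hj
        rw [hyw, sub_self]
      · rw [totD_eq_zero_of_ne x.2 (by omega), totD_eq_zero_of_ne hy (by omega), sub_zero]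

end CosimplicialComplex

theorem proposition3p2 {K : Type v} [Field K] [CharZero K] (X : CosimplicialObject TopCat.{u})
    (hX : IsFormalDiagram K X) (L : Type w) [Field L] [CharZero L] :
    (bousfieldKan L X).CollapsesAt 2 :=
  CosimplicialComplex.collapsesAt_two fun _ _ _ hx =>
    NormalizedChains.totD_mem_of_permanent X (PolyForms.permanent_cochains hX) hx
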